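/- Let $N\ge 1$ and $I_1,\dots,I_N\ge 1$ be integers with $\min_n I_n\ge (N-1)\log_2^2(\max_n I_n)+1$, let $0<\beta\le\alpha$, and let $R,\hat R\in\mathbb N$. For a real $I_1\times\cdots\times I_N$ tensor $T$, let $\mathrm{rank}(T)$ (the CP rank) be the least number of terms in a decomposition $T=\sum_{r} a_r^{(1)}\circ\cdots\circ a_r^{(N)}$ into outer products of vectors $a_r^{(n)}\in\mathbb R^{I_n}$, and let $\mathrm{rank}_+(T)$ (the nonnegative CP rank) be the least number of terms when all the vectors are required to have nonnegative entries. Let $S_R(\beta,\alpha)$ (respectively $S_R^+(\beta,\alpha)$) be the set of tensors $T$ with $\beta\le t_{\mathbf i}\le\alpha$ for every multi-index $\mathbf i$ and $\mathrm{rank}(T)\le R$ (respectively $\mathrm{rank}_+(T)\le R$). Let $\|\cdot\|$ be the Frobenius norm. Let $M$ be a tensor with entries $m_{\mathbf i}\in[\beta,\alpha]$. Let $\Omega$ be a random set of multi-indices, chosen uniformly at random among all sets of a fixed cardinality $|\Omega|$, where $1\le|\Omega|\le I_1\cdots I_N$, and let $X$ be a random tensor with entries in $\{0,1,2,\dots\}$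 such that, given $\Omega$, the entries $x_{\mathbf i}$, $\mathbf i\in\Omega$, are independent with $x_{\mathbf i}\sim\mathrm{Poisson}(m_{\mathbf i})$. Put $f_\Omega(T)=\sum_{\mathbf i\in\Omega}\bigl(x_{\mathbf i}\log t_{\mathbf i}-t_{\mathbf i}\bigr)$, the Poisson log-likelihood on $\Omega$ up to a term that does not depend on $T$. (1) If $M\in S_R^+(\beta,\alpha)$, then with probability greater than $1-\frac{2}{|\Omega|}$ every $\hat M\in S_{\hat R}^+(\beta,\alpha)$ such that $f_\Omega(\hat M)\ge f_\Omega(M)$ satisfies $$\frac{\|M-\hat M\|^2}{\|M\|^2}\le\frac{128\,\alpha(\alpha+1)}{\beta^3}\Bigl(\alpha(e^2-2)+3\log_2|\Omega|\Bigr)\frac{(R+\hat R)\sqrt{\sum_{n=1}^N I_n}}{\sqrt{|\Omega|}}.$$ (2) If $M\in S_R(\beta,\alpha)$, then with probability greater than $1-\frac{2}{|\Omega|}$ every $\hat M\in S_{\hat R}(\beta,\alpha)$ such that $f_\Omega(\hat M)\ge f_\Omega(M)$ satisfies $$\frac{\|M-\hat M\|^2}{\|M\|^2}\le\frac{128\,\alpha(\alpha+1)}{\beta^3}\Bigl(\alpha(e^2-2)+3\log_2|\Omega|\Bigr)\Bigl((R\sqrt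 R)^{N-1}+(\hat R\sqrt{\hat R})^{N-1}\Bigr)\frac{\sqrt{\sum_{n=1}^N I_n}}{\sqrt{|\Omega|}}.$$ -/

import Mathlib

open MeasureTheory ProbabilityTheory

/-- Multi-indices `(i_1, …, i_N)` with `i_n` ranging over `I_n` values. -/
abbrev MultiIndex {N : ℕ} (I : Fin N → ℕ) : Type := (n : Fin N) → Fin (I n)

/-- Real `I_1 × ⋯ × I_N` tensors. The norm of this type is the Frobenius norm. -/
abbrev RealTensor {N : ℕ} (I : Fin N → ℕ) : Type := EuclideanSpace ℝ (MultiIndex I)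

/-- The sum over `r` of the outer products of the vectors `a r 1, …, a r N` is the tensor `T`. -/
def IsCPDecomposition {N : ℕ} {I : Fin N → ℕ} {R : ℕ}
    (a : Fin R → (n : Fin N) → Fin (I n) → ℝ) (T : RealTensor I) : Prop :=
  ∀ i : MultiIndex I, T i = ∑ r : Fin R, ∏ n : Fin N, a r n (i n)

/-- The CP rank: the least number of terms of a CP decomposition (`⊤` if there is none). -/
noncomputable def cpRank {N : ℕ} {I : Fin N → ℕ} (T : RealTensor I) : ℕ∞ :=
  ⨅ (R : ℕ) (_ : ∃ a : Fin R → (n : Fin N) → Fin (I n) → ℝ, IsCPDecomposition a T), (R : ℕ∞)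

/-- The nonnegative CP rank: the least number of terms of a CP decomposition all of whose factor
vectors have nonnegative entries (`⊤` if there is none). -/
noncomputable def nncpRank {N : ℕ} {I : Fin N → ℕ} (T : RealTensor I) : ℕ∞ :=
  ⨅ (R : ℕ) (_ : ∃ a : Fin R → (n : Fin N) → Fin (I n) → ℝ,
    (∀ r n j, 0 ≤ a r n j) ∧ IsCPDecomposition a T), (R : ℕ∞)

/-- The search space `S_R(β, α)`: entries in `[β, α]` and CP rank at most `R`. -/
def cpSpace {N : ℕ} (I : Fin N → ℕ) (R : ℕ) (β α : ℝ) : Set (RealTensor I) :=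
  {T | (∀ i, β ≤ T i ∧ T i ≤ α) ∧ cpRank T ≤ R}

/-- The search space `S_R^+(β, α)`: entries in `[β, α]` and nonnegative CP rank at most `R`. -/
def nncpSpace {N : ℕ} (I : Fin N → ℕ) (R : ℕ) (β α : ℝ) : Set (RealTensor I) :=
  {T | (∀ i, β ≤ T i ∧ T i ≤ α) ∧ nncpRank T ≤ R}

/-- The Poisson log-likelihood of the parameter tensor `T` given the counts `x` on the set `s` of
entries, without the terms `-log (x i)!`, which do not depend on `T`. -/
noncomputable def poissonLogLik {N : ℕ} {I : Fin N → ℕ} (s : Finset (MultiIndex I))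
    (x : MultiIndex I → ℕ) (T : RealTensor I) : ℝ :=
  ∑ i ∈ s, ((x i : ℝ) * Real.log (T i) - T i)

/-- On the probability space `(Λ, P)`, the random set `Ω` of observed entries is uniformly
distributed on the sets of `k` multi-indices, and, given `Ω`, the counts `X i` for `i ∈ Ω` are
independent with `X i ∼ Poisson (M i)`. Nothing is assumed about the counts outside `Ω`. -/
structure IsPoissonSampling {Λ : Type*} [MeasurableSpace Λ] (P : Measure Λ) {N : ℕ}
    {I : Fin N → ℕ} (M : RealTensor I) (k : ℕ) (Ω : Λ → Finset (MultiIndex I))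
    (X : Λ → MultiIndex I → ℕ) : Prop where
  measurableSet_fiber : ∀ s, MeasurableSet (Ω ⁻¹' {s})
  measurable_count : ∀ i, Measurable fun w => X w i
  uniform : ∀ s : Finset (MultiIndex I), s.card = k →
    P.real (Ω ⁻¹' {s}) = 1 / ((Fintype.card (MultiIndex I)).choose k : ℝ)
  law : ∀ s : Finset (MultiIndex I), s.card = k → ∀ i ∈ s,
    (cond P (Ω ⁻¹' {s})).map (fun w => X w i) = poissonMeasure (M i).toNNReal
  indep : ∀ s : Finset (MultiIndex I), s.card = k →
    iIndepFun (fun (i : s) (w : Λ) => X w i) (cond P (Ω ⁻¹' {s}))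

/-! The argument is a uniform deviation bound for the likelihood. Sampling `k` of the `n` entries
without replacement is dominated, up to a factor `n + 1`, by observing each entry independently with
probability `p = k / n` (`IsPoissonSampling.measure_preimage_observedCode_le`). Each entry then
carries one independent code, and the log-likelihood difference of `T` and `M` is a sum of functions
of the codes. Its mean is at most `-p ∑ (T i - M i)² / (4α)` by the quadratic lower bound on the
Poisson divergence, so a far tensor matches the likelihood of `M` only if the centered sum is large.

The exponential moment of the supremum of the scaled centered sum is bounded by symmetrization and
Ledoux–Talagrand contraction, one coordinate at a time (`lintegral_pi_iSup_exp_le_symmetrized`).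
Contraction linearizes the likelihood: what remains is a linear form in `T - M` with independent
symmetric coefficients.

Low rank enters only through `CubeBounded`: `T - M` lies in a multiple of the absolutely convex hull
of outer products of vectors in the cube. A linear form on that hull is controlled by its values at
the `2 ^ ∑ I n` sign tensors, so a union bound over these suffices
(`lintegral_iSup_exp_signedSum_le`). The multiple is `R α` for nonnegative rank and `R ^ (N - 1) α`
for rank, the latter by expanding `T` in its own slices.

Markov's inequality gives the tail bound. When the claimed error is too large for the
small-parameter moment estimate, the trivial bound `α² / β²` already proves it. -/

/-! ### Spanning subfamilies with bounded coefficients. -/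

/-- Among the members of a finite family one can choose a subfamily, no larger than the dimension
of the span, such that every member is a combination of the chosen ones with coefficients in
`[-1, 1]`. -/
theorem exists_subfamily_bounded_coeff {κ E : Type*} [Finite κ] [AddCommGroup E] [Module ℝ E]
    (v : κ → E) :
    ∃ p : Fin (Module.finrank ℝ (Submodule.span ℝ (Set.range v))) → κ, ∃ c : κ → _ → ℝ,
      (∀ j l, |c j l| ≤ 1) ∧ ∀ j, v j = ∑ l, c j l • v (p l) := by
  classical
  set W := Submodule.span ℝ (Set.range v) with hW
  have : FiniteDimensional ℝ W := FiniteDimensional.span_of_finite ℝ (Set.finite_range v)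
  let v' : κ → W := fun j => ⟨v j, Submodule.subset_span ⟨j, rfl⟩⟩
  let b₀ := Module.finBasis ℝ W
  obtain ⟨f, hf, hfs, hfi⟩ := Submodule.exists_fun_fin_finrank_span_eq ℝ (Set.range v)
  choose p₀ hp₀ using hf
  have hli₀ : LinearIndependent ℝ (fun l => v' (p₀ l)) := by
    apply LinearIndependent.of_comp W.subtype
    convert! hfi using 1
    ext l
    exact hp₀ l
  have hdet (p : Fin (Module.finrank ℝ W) → κ) (hp : LinearIndependent ℝ (fun l => v' (p l))) :
      IsUnit (b₀.det (fun l => v' (p l))) := by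
    rw [← Module.Basis.is_basis_iff_det]
    refine ⟨hp, ?_⟩
    exact hp.span_eq_top_of_card_eq_finrank' (by simp)
  have : Nonempty (Fin (Module.finrank ℝ W) → κ) := ⟨p₀⟩
  have : Fintype κ := Fintype.ofFinite κ
  -- Choose the subfamily of largest absolute determinant. By Cramer's rule a coefficient is the
  -- ratio of the determinant after exchanging one vector to the maximal one, hence at most `1` in
  -- absolute value.
  obtain ⟨p, hp⟩ := Finite.exists_max (fun p : Fin (Module.finrank ℝ W) → κ =>
    |b₀.det (fun l => v' (p l))|)
  have hpos : 0 < |b₀.det (fun l => v' (p l))| :=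
    lt_of_lt_of_le (abs_pos.2 (hdet p₀ hli₀).ne_zero) (hp p₀)
  obtain ⟨hli, hsp⟩ := (Module.Basis.is_basis_iff_det b₀).2 (abs_pos.1 hpos).isUnit
  let b : Module.Basis _ ℝ W := Module.Basis.mk hli hsp.ge
  have hb (l) : b l = v' (p l) := by simp [b]
  refine ⟨p, fun j l => b.repr (v' j) l, fun j l => ?_, fun j => ?_⟩
  · have key : b₀.det (fun m => v' (Function.update p l j m)) =
        b.repr (v' j) l * b₀.det (fun l => v' (p l)) := by
      have h1 : (fun m => v' (Function.update p l j m)) =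
          Function.update (fun m => b m) l (v' j) := by
        ext1 m
        by_cases hm : m = l
        · subst hm; simp
        · simp [hm, hb]
      have h2 : (fun l => v' (p l)) = fun l => b l := by ext1 l; rw [hb]
      rw [h1, h2]
      conv_lhs => rw [← b.sum_repr (v' j)]
      rw [AlternatingMap.map_update_sum]
      rw [Finset.sum_eq_single l]
      · rw [AlternatingMap.map_update_smul, Function.update_eq_self, smul_eq_mul]
      · intro m _ hm
        rw [AlternatingMap.map_update_smul, AlternatingMap.map_update_self _ _ hm.symm, smul_zero]
      · simp
    have := hp (Function.update p l j)
    simp only [key, abs_mul] at this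
    exact le_of_mul_le_mul_right (by simpa using this) hpos
  · have := congrArg (Subtype.val) (b.sum_repr (v' j))
    simp only [hb, Submodule.coe_sum, Submodule.coe_smul] at this
    exact this.symm

/-! ### Low rank tensors and the convex hull of cube outer products. -/

section Tensor

variable {N : ℕ} {I : Fin N → ℕ}

/-- The tensor `T` lies in `C` times the absolutely convex hull of the outer products of vectors
with entries in `[-1, 1]`, expressed through linear functionals. -/
def CubeBounded (C : ℝ) (T : MultiIndex I → ℝ) : Prop :=
  ∀ (r : MultiIndex I → ℝ) (K : ℝ),
    (∀ u : (n : Fin N) → Fin (I n) → ℝ, (∀ n j, |u n j| ≤ 1) →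
      |∑ i, r i * ∏ n, u n (i n)| ≤ K) → |∑ i, r i * T i| ≤ C * K

theorem CubeBounded.sub {C C' : ℝ} {T T' : MultiIndex I → ℝ} (h : CubeBounded C T)
    (h' : CubeBounded C' T') : CubeBounded (C + C') (fun i => T i - T' i) := by
  intro r K hK
  have h1 := h r K hK
  have h2 := h' r K hK
  simp only [mul_sub, Finset.sum_sub_distrib]
  calc _ ≤ |∑ i, r i * T i| + |∑ i, r i * T' i| := abs_sub _ _
    _ ≤ _ := by linarith

/-- Divide each factor by its largest entry. The product of these maxima is itself an entry of the
tensor, so the scalar pulled out is at most `C`. -/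
theorem cubeBounded_outer {C : ℝ} (hC : 0 ≤ C) (a : (n : Fin N) → Fin (I n) → ℝ)
    (ha : ∀ n j, 0 ≤ a n j) (haC : ∀ i : MultiIndex I, ∏ n, a n (i n) ≤ C)
    (hI : ∀ n, 0 < I n) : CubeBounded C (fun i => ∏ n, a n (i n)) := by
  intro r K hK
  have hK0 : 0 ≤ K := (abs_nonneg _).trans (hK (fun _ _ => 0) (by simp))
  have hne : ∀ n, Nonempty (Fin (I n)) := fun n => ⟨⟨0, hI n⟩⟩
  have hmax := fun n => Finite.exists_max (a n)
  choose q hq using hmax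
  have hle := haC q
  have h0 : 0 ≤ ∏ n, a n (q n) := Finset.prod_nonneg fun n _ => ha _ _
  have hfac (n) (j) : a n j = a n (q n) * (a n j / a n (q n)) := by
    by_cases h : a n (q n) = 0
    · have : a n j = 0 := le_antisymm (h ▸ hq n j) (ha n j)
      simp [this]
    · field_simp
  have hu := hK (fun n j => a n j / a n (q n)) (fun n j => by
    rw [abs_of_nonneg (div_nonneg (ha _ _) (ha _ _))]
    exact div_le_one_of_le₀ (hq n j) (ha _ _))
  have heq : ∑ i, r i * ∏ n, a n (i n) =
      (∏ n, a n (q n)) * ∑ i : MultiIndex I, r i * ∏ n, (a n (i n) / a n (q n)) := by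
    rw [Finset.mul_sum]
    refine Finset.sum_congr rfl fun i _ => ?_
    rw [mul_left_comm, ← Finset.prod_mul_distrib]
    congr 1
    exact Finset.prod_congr rfl fun n _ => hfac n (i n)
  rw [heq, abs_mul, abs_of_nonneg h0]
  exact mul_le_mul hle hu (abs_nonneg _) hC

theorem CubeBounded.sum {R : ℕ} {C : ℝ} {T : Fin R → MultiIndex I → ℝ}
    (h : ∀ l, CubeBounded C (T l)) : CubeBounded (R * C) (fun i => ∑ l, T l i) := by
  intro r K hK
  have : ∑ i, r i * ∑ l, T l i = ∑ l, ∑ i, r i * T l i := by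
    simp only [Finset.mul_sum]
    exact Finset.sum_comm
  rw [this]
  calc _ ≤ ∑ l, |∑ i, r i * T l i| := Finset.abs_sum_le_sum_abs _ _
    _ ≤ ∑ l : Fin R, C * K := Finset.sum_le_sum fun l _ => h l r K hK
    _ = _ := by simp; ring

theorem CubeBounded.mono {C C' : ℝ} (hC : C ≤ C') {T : MultiIndex I → ℝ} (h : CubeBounded C T) :
    CubeBounded C' T := by
  intro r K hK
  have hK0 : 0 ≤ K := (abs_nonneg _).trans (hK (fun _ _ => 0) (by simp))
  exact (h r K hK).trans (mul_le_mul_of_nonneg_right hC hK0)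

theorem exists_decomposition_of_cpRank_le {T : RealTensor I} {R : ℕ} (h : cpRank T ≤ R) :
    ∃ R' ≤ R, ∃ a : Fin R' → (n : Fin N) → Fin (I n) → ℝ, IsCPDecomposition a T := by
  by_contra! hcon
  have : ((R + 1 : ℕ) : ℕ∞) ≤ cpRank T := by
    refine le_iInf₂ fun R' ⟨a, ha⟩ => ?_
    by_contra hlt
    exact hcon R' (Nat.lt_succ_iff.1 (by exact_mod_cast not_le.1 hlt)) a ha
  have := this.trans h
  norm_cast at this
  omega

theorem exists_decomposition_of_nncpRank_le {T : RealTensor I} {R : ℕ} (h : nncpRank T ≤ R) :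
    ∃ R' ≤ R, ∃ a : Fin R' → (n : Fin N) → Fin (I n) → ℝ,
      (∀ r n j, 0 ≤ a r n j) ∧ IsCPDecomposition a T := by
  by_contra! hcon
  have : ((R + 1 : ℕ) : ℕ∞) ≤ nncpRank T := by
    refine le_iInf₂ fun R' ⟨a, ha⟩ => ?_
    by_contra hlt
    exact hcon R' (Nat.lt_succ_iff.1 (by exact_mod_cast not_le.1 hlt)) a ha.1 ha.2
  have := this.trans h
  norm_cast at this
  omega

/-- Nonnegative terms cannot cancel, so every rank-one term is bounded entrywise by the sum and
hence by `α`. -/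
theorem cubeBounded_of_nncpSpace {R : ℕ} {β α : ℝ} (hα : 0 ≤ α) (hI : ∀ n, 0 < I n)
    {T : RealTensor I} (hT : T ∈ nncpSpace I R β α) : CubeBounded (R * α) (fun i => T i) := by
  obtain ⟨R', hR', a, ha0, ha⟩ := exists_decomposition_of_nncpRank_le hT.2
  have hT' : (fun i => T i) = fun i => ∑ l, ∏ n, a l n (i n) := by ext i; exact ha i
  have hterm (l : Fin R') (i : MultiIndex I) : ∏ n, a l n (i n) ≤ α := by
    refine le_trans ?_ (hT.1 i).2
    rw [ha i]
    exact Finset.single_le_sum (f := fun l => ∏ n, a l n (i n))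
      (fun l _ => Finset.prod_nonneg fun n _ => ha0 _ _ _) (Finset.mem_univ l)
  rw [hT']
  refine CubeBounded.mono ?_ (CubeBounded.sum fun l => cubeBounded_outer hα (a l) (ha0 l)
    (hterm l) hI)
  gcongr

/-- Along one mode, a tensor of CP rank at most `R` is a combination of at most `R` of its slices
with coefficients in `[-1, 1]`. -/
theorem IsCPDecomposition.exists_slices {R : ℕ} {a : Fin R → (n : Fin N) → Fin (I n) → ℝ}
    {T : RealTensor I} (ha : IsCPDecomposition a T) (n : Fin N) :
    ∃ s ≤ R, ∃ p : Fin s → Fin (I n), ∃ c : Fin s → Fin (I n) → ℝ,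
      (∀ l j, |c l j| ≤ 1) ∧ ∀ i, T i = ∑ l, c l (i n) * T (Function.update i n (p l)) := by
  let v : Fin (I n) → MultiIndex I → ℝ := fun j i => T (Function.update i n j)
  let w : Fin R → MultiIndex I → ℝ := fun r i => ∏ m ∈ Finset.univ.erase n, a r m (i m)
  have hv (j) : v j = ∑ r, a r n j • w r := by
    ext i
    simp only [v, w, ha _, Finset.sum_apply, Pi.smul_apply, smul_eq_mul]
    refine Finset.sum_congr rfl fun r _ => ?_
    rw [← Finset.mul_prod_erase _ _ (Finset.mem_univ n), Function.update_self]
    congr 1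
    refine Finset.prod_congr rfl fun m hm => ?_
    rw [Function.update_of_ne (Finset.ne_of_mem_erase hm)]
  have hspan : Submodule.span ℝ (Set.range v) ≤ Submodule.span ℝ (Set.range w) := by
    rw [Submodule.span_le]
    rintro _ ⟨j, rfl⟩
    rw [hv j]
    exact Submodule.sum_mem _ fun r _ => Submodule.smul_mem _ _ (Submodule.subset_span ⟨r, rfl⟩)
  obtain ⟨p, c, hc, hvc⟩ := exists_subfamily_bounded_coeff v
  refine ⟨_, ?_, p, fun l j => c j l, fun l j => hc j l, fun i => ?_⟩
  · calc _ ≤ Module.finrank ℝ (Submodule.span ℝ (Set.range w)) :=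
          Submodule.finrank_mono hspan
      _ ≤ R := by simpa [Set.finrank] using finrank_range_le_card (R := ℝ) w
  · have := congrFun (hvc (i n)) i
    simpa [v] using this

/-- The terms of a CP decomposition may be huge and cancel, so `T` is expanded in its own slices
along all modes but one. This gives at most `R ^ (N - 1)` terms, each an outer product of
coefficient vectors in the cube and a fibre of `T`, whose entries are bounded by `α`. -/
theorem cubeBounded_of_cpSpace {R : ℕ} {β α : ℝ} (hN : 1 ≤ N) (hI : ∀ n, 0 < I n)
    (hβ : 0 < β) (hα : 0 < α)     {T : RealTensor I} (hT : T ∈ cpSpace I R β α) :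
    CubeBounded ((R : ℝ) ^ (N - 1) * α) (fun i => T i) := by
  classical
  obtain ⟨R', hR', a, ha⟩ := exists_decomposition_of_cpRank_le hT.2
  choose s hs p c hc hTc using fun n => ha.exists_slices n
  have habs (i) : |T i| ≤ α := by
    rw [abs_of_pos (hβ.trans_le (hT.1 i).1)]
    exact (hT.1 i).2
  intro r K hK
  have hK0 : 0 ≤ K := (abs_nonneg _).trans (hK (fun _ _ => 0) (by simp))
  -- `S` is the set of modes already expanded: there the index of `T` is frozen at `o` and the
  -- dependence on `i` has moved to the coefficient vectors `u n`.
  have main (S : Finset (Fin N)) : ∀ K' : ℝ,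
      (∀ u : (n : Fin N) → Fin (I n) → ℝ, (∀ n j, |u n j| ≤ 1) → ∀ o : MultiIndex I,
        |∑ i, r i * ((∏ n ∈ S, u n (i n)) * T (S.piecewise o i))| ≤ K') →
      |∑ i, r i * T i| ≤ (R : ℝ) ^ S.card * K' := by
    induction S using Finset.induction_on with
    | empty =>
      intro K' h
      simpa using h (fun _ _ => 0) (by simp) fun n => ⟨0, hI n⟩
    | insert n S hn ih =>
      intro K' h
      rw [Finset.card_insert_of_notMem hn, pow_succ, mul_assoc]
      refine ih _ fun u hu o => ?_
      have hexp : ∑ i, r i * ((∏ m ∈ S, u m (i m)) * T (S.piecewise o i)) =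
          ∑ l : Fin (s n), ∑ i, r i * ((∏ m ∈ insert n S, Function.update u n (c n l) m (i m)) *
            T ((insert n S).piecewise (Function.update o n (p n l)) i)) := by
        rw [Finset.sum_comm]
        refine Finset.sum_congr rfl fun i _ => ?_
        rw [hTc n (S.piecewise o i), Finset.mul_sum, Finset.mul_sum]
        refine Finset.sum_congr rfl fun l _ => ?_
        rw [Finset.prod_insert hn, Function.update_self, Finset.piecewise_eq_of_notMem _ _ _ hn]
        have h1 : ∏ m ∈ S, Function.update u n (c n l) m (i m) = ∏ m ∈ S, u m (i m) := by
          refine Finset.prod_congr rfl fun m hm => ?_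
          rw [Function.update_of_ne (ne_of_mem_of_not_mem hm hn)]
        have h2 : (insert n S).piecewise (Function.update o n (p n l)) i =
            Function.update (S.piecewise o i) n (p n l) := by
          rw [Finset.piecewise_insert, Function.update_self]
          congr 1
          ext1 m
          by_cases hm : m ∈ S
          · simp [hm, Function.update_of_ne (ne_of_mem_of_not_mem hm hn)]
          · simp [hm]
        rw [h1, h2]
        ring
      rw [hexp]
      calc _ ≤ ∑ l : Fin (s n), |∑ i, r i *
              ((∏ m ∈ insert n S, Function.update u n (c n l) m (i m)) *
                T ((insert n S).piecewise (Function.update o n (p n l)) i))| :=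
            Finset.abs_sum_le_sum_abs _ _
        _ ≤ ∑ l : Fin (s n), K' := by
            refine Finset.sum_le_sum fun l _ => h _ (fun m j => ?_) _
            by_cases hm : m = n
            · subst hm; simpa using hc m l j
            · simpa [hm] using hu m j
        _ = s n * K' := by simp
        _ ≤ R * K' := by
            have : 0 ≤ K' := (abs_nonneg _).trans (h u hu o)
            have h3 : ((s n : ℕ) : ℝ) ≤ R := by exact_mod_cast (hs n).trans hR'
            gcongr
  let n₀ : Fin N := ⟨0, hN⟩
  have := main (Finset.univ.erase n₀) (α * K) (fun u hu o => ?_)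
  · rw [Finset.card_erase_of_mem (Finset.mem_univ _), Finset.card_univ, Fintype.card_fin] at this
    simpa [mul_assoc] using this
  · have hK' := hK (Function.update u n₀ fun j => T (Function.update o n₀ j) / α) (fun n j => by
      by_cases hn : n = n₀
      · subst hn
        rw [Function.update_self, abs_div, abs_of_pos hα]
        exact div_le_one_of_le₀ (habs _) hα.le
      · simpa [hn] using hu n j)
    have heq : ∑ i, r i * ((∏ n ∈ Finset.univ.erase n₀, u n (i n)) *
        T ((Finset.univ.erase n₀).piecewise o i)) = α * ∑ i : MultiIndex I, r i *
          ∏ n, Function.update u n₀ (fun j => T (Function.update o n₀ j) / α) n (i n) := by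
      rw [Finset.mul_sum]
      refine Finset.sum_congr rfl fun i _ => ?_
      rw [← Finset.mul_prod_erase _ _ (Finset.mem_univ n₀), Function.update_self]
      have h1 : ∏ m ∈ Finset.univ.erase n₀,
          Function.update u n₀ (fun j => T (Function.update o n₀ j) / α) m (i m) =
          ∏ m ∈ Finset.univ.erase n₀, u m (i m) := by
        refine Finset.prod_congr rfl fun m hm => ?_
        rw [Function.update_of_ne (Finset.ne_of_mem_erase hm)]
      have h2 : (Finset.univ.erase n₀).piecewise o i = Function.update o n₀ (i n₀) := by
        ext1 m
        by_cases hm : m = n₀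
        · subst hm; simp
        · simp [hm]
      rw [h1, h2]
      field_simp
    rw [heq, abs_mul, abs_of_pos hα]
    gcongr

/-! ### Reduction to sign tensors. -/

/-- The real number `1` or `-1` encoded by a Boolean. -/
def boolSign (b : Bool) : ℝ := if b then 1 else -1

theorem abs_boolSign (b : Bool) : |boolSign b| = 1 := by cases b <;> simp [boolSign]

theorem exists_boolSign_mul_eq_abs (c : ℝ) : ∃ b, boolSign b * c = |c| := by
  rcases le_total 0 c with h | h
  · exact ⟨true, by simp [boolSign, abs_of_nonneg h]⟩
  · exact ⟨false, by simp [boolSign, abs_of_nonpos h]⟩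

/-- A linear functional on outer products of vectors with entries in `[-1, 1]` is largest at
vectors of signs. -/
theorem exists_boolSign_outer (r : MultiIndex I → ℝ) (u : (n : Fin N) → Fin (I n) → ℝ)
    (hu : ∀ n j, |u n j| ≤ 1) :
    ∃ σ : (n : Fin N) → Fin (I n) → Bool,
      ∑ i, r i * ∏ n, u n (i n) ≤ ∑ i, r i * ∏ n, boolSign (σ n (i n)) := by
  classical
  have main (S : Finset (Fin N)) : ∃ σ : (n : Fin N) → Fin (I n) → Bool,
      ∑ i, r i * ∏ n, u n (i n) ≤
        ∑ i, r i * ((∏ n ∈ S, boolSign (σ n (i n))) * ∏ n ∈ Sᶜ, u n (i n)) := by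
    induction S using Finset.induction_on with
    | empty => exact ⟨fun _ _ => true, by simp⟩
    | insert n S hn ih =>
      obtain ⟨σ, hσ⟩ := ih
      -- `c j` is the coefficient of `u n j` when all other modes are held fixed; the form is linear
      -- in the `n`-th vector, so the signs of `c` do best.
      let c : Fin (I n) → ℝ := fun j => ∑ i : MultiIndex I with i n = j,
        r i * ((∏ m ∈ S, boolSign (σ m (i m))) * ∏ m ∈ (insert n S)ᶜ, u m (i m))
      have hc (v : Fin (I n) → ℝ) : ∑ j, v j * c j = ∑ i : MultiIndex I, r i *
          ((∏ m ∈ S, boolSign (σ m (i m))) * (v (i n) * ∏ m ∈ (insert n S)ᶜ, u m (i m))) := by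
        rw [← Finset.sum_fiberwise (s := Finset.univ) (g := fun i : MultiIndex I => i n)]
        refine Finset.sum_congr rfl fun j _ => ?_
        rw [Finset.mul_sum]
        refine Finset.sum_congr rfl fun i hi => ?_
        rw [(Finset.mem_filter.1 hi).2]
        ring
      choose b hb using fun j => exists_boolSign_mul_eq_abs (c j)
      refine ⟨Function.update σ n b, hσ.trans ?_⟩
      have hcompl : Sᶜ = insert n (insert n S)ᶜ := by
        ext m
        by_cases hm : m = n
        · subst hm; simp [hn]
        · simp [hm]
      calc _ = ∑ j, u n j * c j := by
            rw [hc]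
            refine Finset.sum_congr rfl fun i _ => ?_
            rw [hcompl, Finset.prod_insert (by simp)]
        _ ≤ ∑ j, boolSign (b j) * c j := by
            refine Finset.sum_le_sum fun j _ => ?_
            rw [hb]
            calc _ ≤ |u n j * c j| := le_abs_self _
              _ = |u n j| * |c j| := abs_mul _ _
              _ ≤ 1 * |c j| := by gcongr; exact hu n j
              _ = _ := one_mul _
        _ = _ := by
            rw [hc]
            refine Finset.sum_congr rfl fun i _ => ?_
            rw [Finset.prod_insert hn, Function.update_self]
            have : ∏ m ∈ S, boolSign (Function.update σ n b m (i m)) =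
                ∏ m ∈ S, boolSign (σ m (i m)) := by
              refine Finset.prod_congr rfl fun m hm => ?_
              rw [Function.update_of_ne (ne_of_mem_of_not_mem hm hn)]
            rw [this]
            ring
  obtain ⟨σ, hσ⟩ := main Finset.univ
  exact ⟨σ, by simpa using hσ⟩

/-- The outer product of vectors of signs. -/
def signTensor (σ : (n : Fin N) → Fin (I n) → Bool) (i : MultiIndex I) : ℝ :=
  ∏ n, boolSign (σ n (i n))

theorem abs_signTensor (σ : (n : Fin N) → Fin (I n) → Bool) (i : MultiIndex I) :
    |signTensor σ i| = 1 := by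
  simp [signTensor, Finset.abs_prod, abs_boolSign]

theorem CubeBounded.exists_signTensor {C : ℝ} {T : MultiIndex I → ℝ}
    (h : CubeBounded C T) (r : MultiIndex I → ℝ) :
    ∃ σ : (n : Fin N) → Fin (I n) → Bool,
      ∑ i, r i * T i ≤ C * |∑ i, r i * signTensor σ i| := by
  obtain ⟨σ, hσ⟩ := Finite.exists_max fun σ : (n : Fin N) → Fin (I n) → Bool =>
    |∑ i, r i * signTensor σ i|
  refine ⟨σ, (le_abs_self _).trans (h r _ fun u hu => abs_le.2 ⟨?_, ?_⟩)⟩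
  · obtain ⟨τ, hτ⟩ := exists_boolSign_outer (fun i => -r i) u hu
    have h1 := (neg_le_abs _).trans (hσ τ)
    simp only [neg_mul, Finset.sum_neg_distrib] at hτ
    simp only [signTensor] at h1 ⊢
    linarith
  · obtain ⟨τ, hτ⟩ := exists_boolSign_outer r u hu
    exact hτ.trans ((le_abs_self _).trans (hσ τ))

end Tensor

/-! ### Symmetrization and contraction for exponential moments. -/

section Contraction

open scoped ENNReal

/-- If `Q * exp g ≤ P`, then `Q * exp g + P * exp (-g) ≤ P + Q`, because `(P - Q * exp g) * (1 - exp
(-g)) ≥ 0`. Otherwise `P * exp (-g) ≤ Q`, and the two bounds add up directly. -/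
theorem add_le_add_of_le_exp {X Y P Q g : ℝ} (hg : 0 ≤ g)
    (hXP : X ≤ P) (hXQ : X ≤ Q * Real.exp g) (hY : Y ≤ P * Real.exp (-g)) : X + Y ≤ P + Q := by
  have h1 : Real.exp g * Real.exp (-g) = 1 := by rw [← Real.exp_add]; simp
  have h2 : Real.exp (-g) ≤ 1 := Real.exp_le_one_iff.2 (by linarith)
  have h3 := Real.exp_pos (-g)
  rcases le_total (Q * Real.exp g) P with h | h
  · have := mul_le_mul_of_nonneg_right h (sub_nonneg.2 h2)
    rw [mul_sub, mul_sub, mul_one, mul_one, mul_assoc, h1, mul_one] at this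
    linarith
  · have := mul_le_mul_of_nonneg_right h h3.le
    rw [mul_assoc, h1] at this
    linarith

/-- If `x` and `x'` have opposite signs, one summand is below `P` and the other below `Q`. If the
signs agree, the slack `g` between the `y` and the `x` with the smaller absolute value is what the
Lipschitz condition takes off the other summand. -/
theorem exp_contraction_pair {a a' P Q x x' y y' : ℝ} (ha : 0 ≤ a) (ha' : 0 ≤ a')
    (hP : a * Real.exp x ≤ P) (hQ : a * Real.exp (-x) ≤ Q)
    (hP' : a' * Real.exp x' ≤ P) (hQ' : a' * Real.exp (-x') ≤ Q)
    (hy : |y| ≤ |x|) (hy' : |y'| ≤ |x'|) (hyy : |y - y'| ≤ |x - x'|) :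
    a * Real.exp y + a' * Real.exp (-y') ≤ P + Q := by
  have hM {A b S u v : ℝ} (hA : 0 ≤ A) (h : A * Real.exp u ≤ S) (hv : v ≤ u + b) :
      A * Real.exp v ≤ S * Real.exp b := by
    calc _ ≤ A * Real.exp (u + b) := by gcongr
      _ = A * Real.exp u * Real.exp b := by rw [Real.exp_add, mul_assoc]
      _ ≤ _ := by gcongr
  have hM0 {A S u v : ℝ} (hA : 0 ≤ A) (h : A * Real.exp u ≤ S) (hv : v ≤ u) :
      A * Real.exp v ≤ S := by
    simpa using hM (b := 0) hA h (by simpa using hv)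
  have b1 := abs_le.1 hy
  have b2 := abs_le.1 hy'
  have b3 := abs_le.1 hyy
  rcases le_total 0 x with hx | hx <;> rcases le_total 0 x' with hx' | hx'
  · rw [abs_of_nonneg hx] at b1
    rw [abs_of_nonneg hx'] at b2
    rcases le_total x' x with hxx | hxx
    · rw [abs_of_nonneg (sub_nonneg.2 hxx)] at b3
      rw [add_comm]
      exact add_le_add_of_le_exp (g := x' - y') (by linarith)
        (hM0 ha' hP' (by linarith)) (hM ha' hQ' (by linarith)) (hM ha hP (by linarith))
    · rw [abs_of_nonpos (sub_nonpos.2 hxx)] at b3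
      exact add_le_add_of_le_exp (g := x + y) (by linarith)
        (hM0 ha hP (by linarith)) (hM ha hQ (by linarith)) (hM ha' hP' (by linarith))
  · rw [abs_of_nonneg hx] at b1
    rw [abs_of_nonpos hx'] at b2
    exact add_le_add (hM0 ha hP (by linarith)) (hM0 ha' hQ' (by linarith))
  · rw [abs_of_nonpos hx] at b1
    rw [abs_of_nonneg hx'] at b2
    rw [add_comm]
    exact add_le_add (hM0 ha' hP' (by linarith)) (hM0 ha hQ (by linarith))
  · rw [abs_of_nonpos hx] at b1
    rw [abs_of_nonpos hx'] at b2
    rw [add_comm P]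
    rcases le_total x' x with hxx | hxx
    · rw [abs_of_nonneg (sub_nonneg.2 hxx)] at b3
      exact add_le_add_of_le_exp (g := y - x) (by linarith)
        (hM0 ha hQ (by linarith)) (hM ha hP (by linarith)) (hM ha' hQ' (by linarith))
    · rw [abs_of_nonpos (sub_nonpos.2 hxx)] at b3
      rw [add_comm]
      exact add_le_add_of_le_exp (g := -x' - y') (by linarith)
        (hM0 ha' hQ' (by linarith)) (hM ha' hP' (by linarith)) (hM ha hQ (by linarith))

variable {J : Type*}

/-- Ledoux–Talagrand contraction for a single fair sign. The weights `c` stand for the factors of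
all other coordinates. -/
theorem iSup_exp_contraction (c : J → ℝ≥0∞) (x y : J → ℝ) (hy : ∀ T, |y T| ≤ |x T|)
    (hyy : ∀ T T', |y T - y T'| ≤ |x T - x T'|) :
    (⨆ T, c T * ENNReal.ofReal (Real.exp (y T))) + (⨆ T, c T * ENNReal.ofReal (Real.exp (-y T))) ≤
      (⨆ T, c T * ENNReal.ofReal (Real.exp (x T))) +
        (⨆ T, c T * ENNReal.ofReal (Real.exp (-x T))) := by
  rcases isEmpty_or_nonempty J with hJ | hJ
  · simp
  set P := ⨆ T, c T * ENNReal.ofReal (Real.exp (x T)) with hP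
  set Q := ⨆ T, c T * ENNReal.ofReal (Real.exp (-x T)) with hQ
  by_cases hPt : P = ∞
  · simp [hPt]
  by_cases hQt : Q = ∞
  · simp [hQt]
  have hcP (T) : c T * ENNReal.ofReal (Real.exp (x T)) ≤ P :=
    le_iSup (fun T => c T * ENNReal.ofReal (Real.exp (x T))) T
  have hcQ (T) : c T * ENNReal.ofReal (Real.exp (-x T)) ≤ Q :=
    le_iSup (fun T => c T * ENNReal.ofReal (Real.exp (-x T))) T
  have hcfin (T) : c T ≠ ∞ := by
    intro h
    have := hcP T
    rw [h, ENNReal.top_mul (by simp [Real.exp_pos])] at this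
    exact hPt (top_le_iff.1 this)
  have htoReal (T) (z : ℝ) : c T * ENNReal.ofReal (Real.exp z) =
      ENNReal.ofReal ((c T).toReal * Real.exp z) := by
    rw [ENNReal.ofReal_mul ENNReal.toReal_nonneg, ENNReal.ofReal_toReal (hcfin T)]
  have hle {T} {z : ℝ} {S : ℝ≥0∞} (hS : S ≠ ∞) (h : c T * ENNReal.ofReal (Real.exp z) ≤ S) :
      (c T).toReal * Real.exp z ≤ S.toReal := by
    rw [htoReal] at h
    exact (ENNReal.ofReal_le_iff_le_toReal hS).1 h
  refine ENNReal.iSup_add_iSup_le fun T T' => ?_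
  rw [htoReal, htoReal, ← ENNReal.ofReal_add (by positivity) (by positivity),
    ← ENNReal.ofReal_toReal (ENNReal.add_ne_top.2 ⟨hPt, hQt⟩), ENNReal.toReal_add hPt hQt]
  exact ENNReal.ofReal_le_ofReal (exp_contraction_pair ENNReal.toReal_nonneg
    ENNReal.toReal_nonneg (hle hPt (hcP T)) (hle hQt (hcQ T)) (hle hPt (hcP T'))
    (hle hQt (hcQ T')) (hy T) (hy T') (hyy T T'))

theorem ofReal_exp_integral_le {A : Type*} [MeasurableSpace A] (μ : Measure A)
    [IsProbabilityMeasure μ] {f : A → ℝ} (hf : Integrable f μ) :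
    ENNReal.ofReal (Real.exp (∫ a, f a ∂μ)) ≤ ∫⁻ a, ENNReal.ofReal (Real.exp (f a)) ∂μ := by
  set m := ∫ a, f a ∂μ with hm
  by_cases htop : ∫⁻ a, ENNReal.ofReal (Real.exp (f a)) ∂μ = ∞
  · simp [htop]
  have hint : Integrable (fun a => Real.exp (f a)) μ := by
    refine ⟨Real.continuous_exp.comp_aestronglyMeasurable hf.1, ?_⟩
    rw [hasFiniteIntegral_iff_ofReal (ae_of_all _ fun a => (Real.exp_pos _).le)]
    exact lt_top_iff_ne_top.2 htop
  rw [← ofReal_integral_eq_lintegral_ofReal hint (ae_of_all _ fun a => (Real.exp_pos _).le)]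
  refine ENNReal.ofReal_le_ofReal ?_
  have hg : Integrable (fun a => Real.exp m * (f a - m + 1)) μ :=
    ((hf.sub (integrable_const m)).add (integrable_const 1)).const_mul _
  calc Real.exp m = ∫ a, Real.exp m * (f a - m + 1) ∂μ := by
        have h1 : ∫ a, (f a - m + 1) ∂μ = 1 := by
          rw [integral_add (by exact hf.sub (integrable_const m)) (integrable_const 1),
            integral_sub hf (integrable_const m), ← hm]
          simp
        rw [integral_const_mul, h1, mul_one]
    _ ≤ ∫ a, Real.exp (f a) ∂μ := by
        refine integral_mono hg hint fun a => ?_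
        calc Real.exp m * (f a - m + 1) ≤ Real.exp m * Real.exp (f a - m) := by
              gcongr; exact Real.add_one_le_exp _
          _ = _ := by rw [← Real.exp_add]; simp

/-- The uniform distribution on the two Booleans. -/
noncomputable def fairCoin : Measure Bool :=
  (2⁻¹ : ℝ≥0∞) • (Measure.dirac true + Measure.dirac false)

instance : IsProbabilityMeasure fairCoin := by
  constructor
  simp [fairCoin, ENNReal.inv_two_add_inv_two]

theorem lintegral_fairCoin (f : Bool → ℝ≥0∞) :
    ∫⁻ b, f b ∂fairCoin = 2⁻¹ * (f true + f false) := by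
  simp [fairCoin, lintegral_add_measure, mul_add]

/-- The distribution of two independent copies and an independent fair sign. -/
noncomputable abbrev symmetrized {A : Type*} [MeasurableSpace A] (κ : Measure A) :
    Measure (A × A × Bool) := κ.prod (κ.prod fairCoin)

/-- The randomly signed sum of the values of `w` at two copies. -/
def signedSum {A : Type*} (w : A → ℝ) (y : A × A × Bool) : ℝ :=
  boolSign y.2.2 * (w y.1 + w y.2.1)

variable {A : Type*} [MeasurableSpace A] [Countable A] [MeasurableSingletonClass A]

theorem lintegral_symmetrized (κ : Measure A) [IsProbabilityMeasure κ]
    (f : A × A × Bool → ℝ≥0∞) :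
    ∫⁻ y, f y ∂symmetrized κ =
      ∫⁻ a, ∫⁻ a', 2⁻¹ * (f (a, a', true) + f (a, a', false)) ∂κ ∂κ := by
  rw [lintegral_prod _ (Measurable.of_discrete.aemeasurable)]
  refine lintegral_congr fun a => ?_
  rw [lintegral_prod _ (Measurable.of_discrete.aemeasurable)]
  exact lintegral_congr fun a' => lintegral_fairCoin _

/-- Symmetrization and contraction for one coordinate. -/
theorem lintegral_iSup_exp_le_symmetrized (κ : Measure A) [IsProbabilityMeasure κ]
    (c : J → ℝ≥0∞) (d : J → ℝ) (ψ : A → J → ℝ) (w : A → ℝ) (hw : ∀ a, 0 ≤ w a)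
    (h0 : ∀ a T, |ψ a T| ≤ w a * |d T|)
    (hlip : ∀ a T T', |ψ a T - ψ a T'| ≤ w a * |d T - d T'|)
    (hint : ∀ T, Integrable (fun a => ψ a T) κ) :
    ∫⁻ a, ⨆ T, c T * ENNReal.ofReal (Real.exp (ψ a T - ∫ a', ψ a' T ∂κ)) ∂κ ≤
      ∫⁻ y, ⨆ T, c T * ENNReal.ofReal (Real.exp (signedSum w y * d T)) ∂symmetrized κ := by
  -- Jensen's inequality replaces the mean by an independent copy. Exchanging the two copies and
  -- averaging the two orders then plays the role of a fair sign.
  let S : A → A → ℝ≥0∞ := fun a a' => ⨆ T, c T * ENNReal.ofReal (Real.exp (ψ a T - ψ a' T))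
  have h1 (a : A) : ⨆ T, c T * ENNReal.ofReal (Real.exp (ψ a T - ∫ a', ψ a' T ∂κ)) ≤
      ∫⁻ a', S a a' ∂κ := by
    refine iSup_le fun T => ?_
    have : ψ a T - ∫ a', ψ a' T ∂κ = ∫ a', (ψ a T - ψ a' T) ∂κ := by
      rw [integral_sub (integrable_const _) (hint T)]
      simp
    rw [this]
    calc _ ≤ c T * ∫⁻ a', ENNReal.ofReal (Real.exp (ψ a T - ψ a' T)) ∂κ := by
          gcongr
          exact ofReal_exp_integral_le κ ((integrable_const _).sub (hint T))
      _ = ∫⁻ a', c T * ENNReal.ofReal (Real.exp (ψ a T - ψ a' T)) ∂κ := by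
          rw [lintegral_const_mul _ Measurable.of_discrete]
      _ ≤ _ := lintegral_mono fun a' =>
          le_iSup (fun T => c T * ENNReal.ofReal (Real.exp (ψ a T - ψ a' T))) T
  rw [lintegral_symmetrized]
  calc _ ≤ ∫⁻ a, ∫⁻ a', S a a' ∂κ ∂κ := lintegral_mono h1
    _ = 2⁻¹ * (∫⁻ a, ∫⁻ a', S a a' ∂κ ∂κ + ∫⁻ a, ∫⁻ a', S a' a ∂κ ∂κ) := by
        rw [lintegral_lintegral_swap (f := fun a a' => S a' a)
          Measurable.of_discrete.aemeasurable, ← two_mul, ← mul_assoc,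
          ENNReal.inv_mul_cancel (by simp) (by simp), one_mul]
    _ = ∫⁻ a, ∫⁻ a', 2⁻¹ * (S a a' + S a' a) ∂κ ∂κ := by
        rw [← lintegral_add_left Measurable.of_discrete,
          ← lintegral_const_mul _ Measurable.of_discrete]
        refine lintegral_congr fun a => ?_
        rw [← lintegral_add_left Measurable.of_discrete,
          ← lintegral_const_mul _ Measurable.of_discrete]
    _ ≤ _ := by
        refine lintegral_mono fun a => lintegral_mono fun a' => ?_
        have := iSup_exp_contraction c (fun T => (w a + w a') * d T) (fun T => ψ a T - ψ a' T)
          (fun T => ?_) (fun T T' => ?_)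
        · simp only [S]
          gcongr 2⁻¹ * ?_
          simpa only [signedSum, boolSign, if_true, Bool.false_eq_true, if_false, one_mul, neg_mul,
            neg_sub] using this
        · rw [abs_mul, abs_of_nonneg (add_nonneg (hw a) (hw a')), add_mul]
          exact (abs_sub _ _).trans (add_le_add (h0 a T) (h0 a' T))
        · rw [← mul_sub, abs_mul, abs_of_nonneg (add_nonneg (hw a) (hw a')), add_mul]
          calc _ = |(ψ a T - ψ a T') - (ψ a' T - ψ a' T')| := by ring_nf
            _ ≤ |ψ a T - ψ a T'| + |ψ a' T - ψ a' T'| := abs_sub _ _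
            _ ≤ _ := add_le_add (hlip a T T') (hlip a' T T')

theorem lintegral_pi_le_of_coordinate {ι : Type*} [Fintype ι] [DecidableEq ι] {B : Type*}
    [MeasurableSpace B] (μ : ι → Measure B) [∀ i, SigmaFinite (μ i)] {f g : (ι → B) → ℝ≥0∞}
    (hf : Measurable f) (hg : Measurable g) (i : ι)
    (h : ∀ x, ∫⁻ y, f (Function.update x i y) ∂μ i ≤ ∫⁻ y, g (Function.update x i y) ∂μ i) :
    ∫⁻ x, f x ∂Measure.pi μ ≤ ∫⁻ x, g x ∂Measure.pi μ := by
  refine lintegral_le_of_lmarginal_le {i} hf hg fun x => ?_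
  rw [lmarginal_singleton, lmarginal_singleton]
  exact h x

variable {ι : Type*} [Fintype ι]

theorem lintegral_pi_prod {B : Type*} [MeasurableSpace B] (μ : ι → Measure B)
    [∀ i, IsProbabilityMeasure (μ i)] (f : ι → B → ℝ≥0∞) (hf : ∀ i, Measurable (f i)) :
    ∫⁻ x, ∏ i, f i (x i) ∂Measure.pi μ = ∏ i, ∫⁻ y, f i y ∂μ i := by
  have := lintegral_prod_eq_prod_lintegral_of_indepFun (μ := Measure.pi μ) Finset.univ
    (fun i x => f i (x i)) (iIndepFun_pi fun i => (hf i).aemeasurable)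
    fun i => (hf i).comp (measurable_pi_apply i)
  rw [this]
  refine Finset.prod_congr rfl fun i _ => ?_
  rw [← (measurePreserving_eval μ i).lintegral_comp (hf i)]

theorem ofReal_exp_sum {ι : Type*} (s : Finset ι) (f : ι → ℝ) :
    ENNReal.ofReal (Real.exp (∑ i ∈ s, f i)) = ∏ i ∈ s, ENNReal.ofReal (Real.exp (f i)) := by
  rw [Real.exp_sum, ENNReal.ofReal_prod_of_nonneg fun i _ => (Real.exp_pos _).le]

/-- Symmetrization and contraction for a sum of independent centered Lipschitz functions. -/
theorem lintegral_pi_iSup_exp_le_symmetrized (κ : ι → Measure A)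
    [∀ i, IsProbabilityMeasure (κ i)] (d : ι → J → ℝ) (ψ : ι → A → J → ℝ) (w : ι → A → ℝ)
    (hw : ∀ i a, 0 ≤ w i a) (h0 : ∀ i a T, |ψ i a T| ≤ w i a * |d i T|)
    (hlip : ∀ i a T T', |ψ i a T - ψ i a T'| ≤ w i a * |d i T - d i T'|)
    (hint : ∀ i T, Integrable (fun a => ψ i a T) (κ i)) :
    ∫⁻ x, ⨆ T, ENNReal.ofReal (Real.exp (∑ i, (ψ i (x i) T - ∫ a, ψ i a T ∂κ i))) ∂Measure.pi κ ≤
      ∫⁻ y, ⨆ T, ENNReal.ofReal (Real.exp (∑ i, signedSum (w i) (y i) * d i T))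
        ∂Measure.pi (fun i => symmetrized (κ i)) := by
  classical
  -- Hybrid argument: coordinates in `S` are already symmetrized and linearized, the others still
  -- use the centered function of their first copy.
  let g (S : Finset ι) (i : ι) (y : A × A × Bool) (T : J) : ℝ≥0∞ :=
    if i ∈ S then ENNReal.ofReal (Real.exp (signedSum (w i) y * d i T))
    else ENNReal.ofReal (Real.exp (ψ i y.1 T - ∫ a, ψ i a T ∂κ i))
  have hstep (S : Finset ι) : ∫⁻ y, ⨆ T, ∏ i, g ∅ i (y i) T
        ∂Measure.pi (fun i => symmetrized (κ i)) ≤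
      ∫⁻ y, ⨆ T, ∏ i, g S i (y i) T ∂Measure.pi (fun i => symmetrized (κ i)) := by
    induction S using Finset.induction_on with
    | empty => exact le_rfl
    | insert n S hn ih =>
      refine ih.trans (lintegral_pi_le_of_coordinate _ Measurable.of_discrete
        Measurable.of_discrete n fun x => ?_)
      have hprod (S' : Finset ι) (y) (T) : ∏ i, g S' i (Function.update x n y i) T =
          (∏ i ∈ Finset.univ.erase n, g S' i (x i) T) * g S' n y T := by
        rw [← Finset.mul_prod_erase _ _ (Finset.mem_univ n), Function.update_self, mul_comm]
        congr 1
        refine Finset.prod_congr rfl fun i hi => ?_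
        rw [Function.update_of_ne (Finset.ne_of_mem_erase hi)]
      have hins (T) : ∏ i ∈ Finset.univ.erase n, g (insert n S) i (x i) T =
          ∏ i ∈ Finset.univ.erase n, g S i (x i) T := by
        refine Finset.prod_congr rfl fun i hi => ?_
        simp [g, Finset.ne_of_mem_erase hi]
      simp only [hprod, hins]
      have := lintegral_iSup_exp_le_symmetrized (κ n)
        (fun T => ∏ i ∈ Finset.univ.erase n, g S i (x i) T) (d n) (ψ n) (w n) (hw n) (h0 n)
        (hlip n) (hint n)
      convert! this using 1
      · rw [lintegral_symmetrized]
        refine lintegral_congr fun a => ?_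
        simp only [g, hn, if_false]
        rw [lintegral_const, measure_univ, mul_one, ← two_mul, ← mul_assoc,
          ENNReal.inv_mul_cancel (by simp) (by simp), one_mul]
      · simp [g]
  have hmp : MeasurePreserving (fun (y : ι → A × A × Bool) i => (y i).1)
      (Measure.pi fun i => symmetrized (κ i)) (Measure.pi κ) :=
    measurePreserving_pi _ _ fun i => measurePreserving_fst
  rw [← hmp.lintegral_comp Measurable.of_discrete]
  simpa only [g, ofReal_exp_sum, Finset.notMem_empty, Finset.mem_univ, if_true, if_false]
    using hstep Finset.univ

end Contraction

/-! ### Comparison with independently observed entries. -/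

section Sampling

open scoped ENNReal Nat

theorem pow_mul_factorial_le (k j : ℕ) : k ^ j * k ! ≤ k ^ k * j ! := by
  rcases le_total k j with h | h
  · calc k ^ j * k ! = k ^ k * (k ! * k ^ (j - k)) := by
          rw [mul_left_comm, ← pow_add, Nat.add_sub_cancel' h, mul_comm]
      _ ≤ _ := Nat.mul_le_mul_left _ (Nat.factorial_mul_pow_sub_le_factorial h)
  · have h1 := Nat.factorial_mul_descFactorial (Nat.sub_le k j)
    rw [Nat.sub_sub_self h] at h1
    calc k ^ j * k ! = k ^ j * (j ! * k.descFactorial (k - j)) := by rw [h1]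
      _ ≤ k ^ j * (j ! * k ^ (k - j)) := by
          gcongr
          exact Nat.descFactorial_le_pow _ _
      _ = k ^ k * j ! := by
          rw [mul_comm (j !), ← mul_assoc, ← pow_add, Nat.add_sub_cancel' h]

/-- The binomial distribution with parameters `n` and `k / n` gives its mode `k` probability at
least `1 / (n + 1)`. -/
theorem one_le_mul_binomial_mode {n k : ℕ} (hn : 0 < n) (hk : k ≤ n) :
    (1 : ℝ) ≤ (n + 1) * n.choose k * (((k : ℝ) / n) ^ k * (1 - (k : ℝ) / n) ^ (n - k)) := by
  have hn' : (0 : ℝ) < n := by exact_mod_cast hn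
  have hkn : (0 : ℝ) ≤ (n : ℝ) - k := sub_nonneg.2 (by exact_mod_cast hk)
  have hfac (k j : ℕ) : (k : ℝ) ^ j / j ! ≤ (k : ℝ) ^ k / k ! := by
    rw [div_le_div_iff₀ (by positivity) (by positivity)]
    exact_mod_cast pow_mul_factorial_le k j
  have hform (j : ℕ) (hj : j ≤ n) : (k : ℝ) ^ j * ((n : ℝ) - k) ^ (n - j) * n.choose j =
      n ! * ((k : ℝ) ^ j / j !) * (((n - k : ℕ) : ℝ) ^ (n - j) / (n - j)!) := by
    rw [Nat.cast_choose ℝ hj, Nat.cast_sub hk]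
    field_simp
  -- Both `k ^ j / j!` and `(n - k) ^ (n - j) / (n - j)!` are largest at `j = k`, so this is the
  -- largest of the `n + 1` terms in the expansion of `(k + (n - k)) ^ n`.
  have hterm (j : ℕ) (hj : j ≤ n) : (k : ℝ) ^ j * ((n : ℝ) - k) ^ (n - j) * n.choose j ≤
      (k : ℝ) ^ k * ((n : ℝ) - k) ^ (n - k) * n.choose k := by
    rw [hform j hj, hform k hk]
    gcongr n ! * ?_ * ?_
    · exact hfac k j
    · exact hfac (n - k) (n - j)
  have hsum : (n : ℝ) ^ n ≤ (n + 1) * ((k : ℝ) ^ k * ((n : ℝ) - k) ^ (n - k) * n.choose k) := by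
    have := add_pow (k : ℝ) ((n : ℝ) - k) n
    rw [add_sub_cancel] at this
    rw [this]
    refine (Finset.sum_le_card_nsmul _ _ _ fun j hj =>
      hterm j (Nat.lt_succ_iff.1 (Finset.mem_range.1 hj))).trans_eq ?_
    simp
  have h1 : 1 - (k : ℝ) / n = ((n : ℝ) - k) / n := by field_simp
  rw [h1, div_pow, div_pow, div_mul_div_comm, ← pow_add, Nat.add_sub_cancel' hk, ← mul_div_assoc,
    le_div_iff₀ (by positivity), one_mul]
  exact hsum.trans_eq (by ring)

/-- The law of the encoded observation of one entry that is observed with probability `p` and then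
has a Poisson count `x` of mean `m`: the code is `0` without observation and `x + 1` otherwise. -/
noncomputable def observedCount (p m : ℝ) : Measure ℕ :=
  ENNReal.ofReal (1 - p) • Measure.dirac 0 +
    ENNReal.ofReal p • (poissonMeasure m.toNNReal).map Nat.succ

theorem lintegral_observedCount (p m : ℝ) (f : ℕ → ℝ≥0∞) :
    ∫⁻ z, f z ∂observedCount p m = ENNReal.ofReal (1 - p) * f 0 +
      ENNReal.ofReal p * ∫⁻ x, f (x + 1) ∂poissonMeasure m.toNNReal := by
  rw [observedCount, lintegral_add_measure, lintegral_smul_measure, lintegral_smul_measure,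
    lintegral_dirac, lintegral_map Measurable.of_discrete Measurable.of_discrete]
  rfl

theorem isProbabilityMeasure_observedCount {p : ℝ} (hp0 : 0 ≤ p) (hp1 : p ≤ 1) (m : ℝ) :
    IsProbabilityMeasure (observedCount p m) := by
  constructor
  have := lintegral_observedCount p m 1
  simp only [Pi.one_apply, lintegral_one, measure_univ, mul_one] at this
  rw [this, ← ENNReal.ofReal_add (by linarith) hp0]
  simp

theorem observedCount_zero (p m : ℝ) : observedCount p m {0} = ENNReal.ofReal (1 - p) := by
  have h : Nat.succ ⁻¹' {0} = ∅ := by ext; simp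
  rw [observedCount, Measure.add_apply, Measure.smul_apply, Measure.smul_apply,
    Measure.map_apply Measurable.of_discrete (.singleton _), h]
  simp

theorem observedCount_succ (p m : ℝ) (x : ℕ) :
    observedCount p m {x + 1} = ENNReal.ofReal p * poissonMeasure m.toNNReal {x} := by
  have h : Nat.succ ⁻¹' {x + 1} = {x} := by ext; simp
  rw [observedCount, Measure.add_apply, Measure.smul_apply, Measure.smul_apply,
    Measure.map_apply Measurable.of_discrete (.singleton _), h]
  simp

theorem lintegral_exp_poissonMeasure {m : ℝ} (hm : 0 ≤ m) (s : ℝ) :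
    ∫⁻ x, ENNReal.ofReal (Real.exp (s * (x : ℕ))) ∂poissonMeasure m.toNNReal =
      ENNReal.ofReal (Real.exp (m * (Real.exp s - 1))) := by
  have hs : HasSum (fun n : ℕ => Real.exp (-m) * m ^ n / n ! * Real.exp (s * n))
      (Real.exp (m * (Real.exp s - 1))) := by
    have := (NormedSpace.expSeries_div_hasSum_exp (m * Real.exp s)).mul_left (Real.exp (-m))
    rw [← Real.exp_eq_exp_ℝ, ← Real.exp_add] at this
    convert! this using 1
    · ext n
      rw [mul_pow, ← Real.exp_nat_mul, mul_comm (n : ℝ) s]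
      ring
    · ring_nf
  rw [poissonMeasure, lintegral_sum_measure, ← hs.tsum_eq,
    ENNReal.ofReal_tsum_of_nonneg (fun n => by positivity) hs.summable]
  refine tsum_congr fun n => ?_
  rw [lintegral_smul_measure, lintegral_dirac, smul_eq_mul, Real.coe_toNNReal _ hm,
    ← ENNReal.ofReal_mul (by positivity)]

theorem hasSum_mean_poisson (m : ℝ) :
    HasSum (fun n : ℕ => Real.exp (-m) * m ^ n / n ! * n) m := by
  rw [← hasSum_nat_add_iff' 1]
  have := (NormedSpace.expSeries_div_hasSum_exp m).mul_left (m * Real.exp (-m))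
  rw [← Real.exp_eq_exp_ℝ, mul_assoc, ← Real.exp_add] at this
  convert! this using 1
  · ext n
    rw [Nat.factorial_succ]
    push_cast
    field_simp
    ring
  · simp

theorem integrable_natCast_poissonMeasure {m : ℝ} (hm : 0 ≤ m) :
    Integrable (fun x : ℕ => (x : ℝ)) (poissonMeasure m.toNNReal) := by
  rw [integrable_poissonMeasure_iff, Real.coe_toNNReal _ hm]
  simpa using (hasSum_mean_poisson m).summable

theorem integral_natCast_poissonMeasure {m : ℝ} (hm : 0 ≤ m) :
    ∫ x, (x : ℝ) ∂poissonMeasure m.toNNReal = m := by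
  rw [integral_poissonMeasure, Real.coe_toNNReal _ hm]
  simpa using (hasSum_mean_poisson m).tsum_eq

/-- The contribution `x a - c` of an observed count `x`, in terms of the code of the observation;
an entry without observation contributes nothing. -/
def contribution (a c : ℝ) : ℕ → ℝ
  | 0 => 0
  | x + 1 => x * a - c

theorem integrable_contribution {p m : ℝ} (hm : 0 ≤ m) (a c : ℝ) :
    Integrable (contribution a c) (observedCount p m) := by
  rw [observedCount, integrable_add_measure]
  constructor
  · exact (integrable_dirac (by simp)).smul_measure ENNReal.ofReal_ne_top
  · refine Integrable.smul_measure ?_ ENNReal.ofReal_ne_top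
    rw [integrable_map_measure Measurable.of_discrete.aestronglyMeasurable
      Measurable.of_discrete.aemeasurable]
    exact ((integrable_natCast_poissonMeasure hm).mul_const a).sub (integrable_const c)

theorem integral_contribution {p m : ℝ} (hp0 : 0 ≤ p) (hm : 0 ≤ m) (a c : ℝ) :
    ∫ z, contribution a c z ∂observedCount p m = p * (m * a - c) := by
  have hint := integrable_contribution (p := p) hm a c
  rw [observedCount, integrable_add_measure] at hint
  rw [observedCount, integral_add_measure hint.1 hint.2, integral_smul_measure,
    integral_smul_measure, integral_dirac, integral_map Measurable.of_discrete.aemeasurable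
      Measurable.of_discrete.aestronglyMeasurable]
  have : ∫ x : ℕ, contribution a c x.succ ∂poissonMeasure m.toNNReal = m * a - c := by
    change ∫ x : ℕ, ((x : ℝ) * a - c) ∂_ = _
    rw [integral_sub ((integrable_natCast_poissonMeasure hm).mul_const a) (integrable_const c),
      integral_mul_const, integral_natCast_poissonMeasure hm]
    simp
  rw [this]
  simp [contribution, ENNReal.toReal_ofReal hp0]

variable {N : ℕ} {I : Fin N → ℕ} {Λ : Type*} [MeasurableSpace Λ] {P : Measure Λ}
  {M : RealTensor I} {k : ℕ} {Ω : Λ → Finset (MultiIndex I)} {X : Λ → MultiIndex I → ℕ}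

/-- The tensor of codes of the observations. -/
def observedCode (Ω : Λ → Finset (MultiIndex I)) (X : Λ → MultiIndex I → ℕ) (w : Λ)
    (i : MultiIndex I) : ℕ := if i ∈ Ω w then X w i + 1 else 0

theorem poissonLogLik_sub_eq_sum_contribution {Λ : Type*} (Ω : Λ → Finset (MultiIndex I))
    (X : Λ → MultiIndex I → ℕ) (w : Λ) (T T' : RealTensor I) :
    poissonLogLik (Ω w) (X w) T - poissonLogLik (Ω w) (X w) T' =
      ∑ i, contribution (Real.log (T i) - Real.log (T' i)) (T i - T' i)
        (observedCode Ω X w i) := by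
  rw [poissonLogLik, poissonLogLik, ← Finset.sum_sub_distrib, ← Finset.sum_subset
    (Finset.subset_univ (Ω w))]
  · refine Finset.sum_congr rfl fun i hi => ?_
    simp only [observedCode, hi, if_true, contribution]
    ring
  · intro i _ hi
    simp [observedCode, hi, contribution]

theorem IsPoissonSampling.measurable_observedCode (hX : IsPoissonSampling P M k Ω X) :
    Measurable (observedCode Ω X) := by
  classical
  refine measurable_pi_iff.2 fun i => Measurable.ite ?_ ((hX.measurable_count i).add_const 1)
    measurable_const
  have : {w | i ∈ Ω w} = ⋃ s ∈ {s : Finset (MultiIndex I) | i ∈ s}, Ω ⁻¹' {s} := by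
    ext w; simp
  rw [this]
  exact MeasurableSet.biUnion (Set.to_countable _) fun s _ => hX.measurableSet_fiber s

variable [IsProbabilityMeasure P]

/-- The prescribed probabilities of the `k`-element sets already sum to `1`. -/
theorem IsPoissonSampling.measure_fiber_eq_zero (hX : IsPoissonSampling P M k Ω X)
    (hk : k ≤ Fintype.card (MultiIndex I)) {s : Finset (MultiIndex I)} (hs : s.card ≠ k) :
    P (Ω ⁻¹' {s}) = 0 := by
  classical
  have hdisj : (Set.univ : Set (Finset (MultiIndex I))).PairwiseDisjoint fun s => Ω ⁻¹' {s} :=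
    fun s _ t _ hst => Disjoint.preimage _ (by simpa using hst)
  have htot : ∑ s : Finset (MultiIndex I), P.real (Ω ⁻¹' {s}) = 1 := by
    rw [← measureReal_biUnion_finset (fun s _ t _ h => hdisj trivial trivial h)
      fun s _ => hX.measurableSet_fiber s]
    have : ⋃ s ∈ (Finset.univ : Finset (Finset (MultiIndex I))), Ω ⁻¹' {s} = Set.univ := by
      ext w; simp
    rw [this]
    simp
  have hpart : ∑ s ∈ Finset.powersetCard k (Finset.univ : Finset (MultiIndex I)),
      P.real (Ω ⁻¹' {s}) = 1 := by
    rw [Finset.sum_congr rfl fun s hs => hX.uniform s (Finset.mem_powersetCard.1 hs).2]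
    have : ((Fintype.card (MultiIndex I)).choose k : ℝ) ≠ 0 := by
      exact_mod_cast (Nat.choose_pos hk).ne'
    rw [Finset.sum_const, Finset.card_powersetCard, nsmul_eq_mul, Finset.card_univ]
    field_simp
  rw [← Finset.sum_sdiff (Finset.subset_univ (Finset.powersetCard k Finset.univ)), hpart,
    add_eq_right, Finset.sum_eq_zero_iff_of_nonneg fun _ _ => measureReal_nonneg] at htot
  have := htot s (by simp [Finset.mem_powersetCard, hs])
  rwa [measureReal_eq_zero_iff] at this

/-- Up to the factor `n + 1`, the law of the observations is dominated by the law that they have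
when each entry is observed independently with probability `k / n`. -/
theorem IsPoissonSampling.measure_preimage_observedCode_le (hX : IsPoissonSampling P M k Ω X)
    (hcard : 0 < Fintype.card (MultiIndex I)) (hk : k ≤ Fintype.card (MultiIndex I))
    (B : Set (MultiIndex I → ℕ)) :
    P (observedCode Ω X ⁻¹' B) ≤ (Fintype.card (MultiIndex I) + 1 : ℕ) *
      Measure.pi (fun i => observedCount ((k : ℝ) / Fintype.card (MultiIndex I)) (M i)) B := by
  classical
  set n := Fintype.card (MultiIndex I) with hn
  set p : ℝ := (k : ℝ) / n with hp
  have hp0 : 0 ≤ p := by positivity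
  have hp1 : p ≤ 1 := div_le_one_of_le₀ (by exact_mod_cast hk) (by positivity)
  have hprob (i) := isProbabilityMeasure_observedCount hp0 hp1 (M i)
  have hZ := hX.measurable_observedCode
  -- The codes form a countable space, so singletons suffice. Both laws give the same Poisson
  -- product there; the remaining factors are `1 / n.choose k` and `p ^ k * (1 - p) ^ (n - k)`,
  -- compared through the binomial mode.
  have hsing (z : MultiIndex I → ℕ) : P (observedCode Ω X ⁻¹' {z}) ≤
      (n + 1 : ℕ) * Measure.pi (fun i => observedCount p (M i)) {z} := by
    set s : Finset (MultiIndex I) := Finset.univ.filter fun i => z i ≠ 0 with hs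
    have hsub : observedCode Ω X ⁻¹' {z} = Ω ⁻¹' {s} ∩
        ⋂ i : s, (fun w => X w i) ⁻¹' {z i - 1} := by
      ext w
      simp only [Set.mem_preimage, Set.mem_singleton_iff, Set.mem_inter_iff, Set.mem_iInter]
      constructor
      · rintro rfl
        have : Ω w = s := by
          ext i
          by_cases h : i ∈ Ω w <;> simp [hs, observedCode, h]
        refine ⟨this, fun i => ?_⟩
        have hi : (i : MultiIndex I) ∈ Ω w := by rw [this]; exact i.2
        simp [observedCode, hi]
      · rintro ⟨h1, h2⟩
        ext i
        by_cases hi : i ∈ s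
        · have h3 := h2 ⟨i, hi⟩
          have h4 : z i ≠ 0 := by simpa [hs] using hi
          simp only at h3
          rw [observedCode, h1, if_pos hi, h3]
          omega
        · have h4 : z i = 0 := by simpa [hs] using hi
          rw [observedCode, h1, if_neg hi, h4]
    by_cases hsk : s.card = k
    swap
    · refine le_trans (measure_mono (hsub.trans_subset Set.inter_subset_left)) ?_
      rw [hX.measure_fiber_eq_zero hk hsk]
      exact zero_le
    have hfib : P (Ω ⁻¹' {s}) = ENNReal.ofReal (1 / (n.choose k : ℝ)) := by
      rw [← hX.uniform s hsk, ofReal_measureReal]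
    have hcond : cond P (Ω ⁻¹' {s}) (⋂ i : s, (fun w => X w i) ⁻¹' {z i - 1}) =
        ∏ i ∈ s, poissonMeasure (M i).toNNReal {z i - 1} := by
      rw [(hX.indep s hsk).meas_iInter fun i => ⟨_, .singleton _, rfl⟩]
      refine Eq.trans ?_ (Finset.prod_coe_sort s fun i => poissonMeasure (M i).toNNReal {z i - 1})
      refine Finset.prod_congr rfl fun i _ => ?_
      rw [← hX.law s hsk i i.2, Measure.map_apply (hX.measurable_count i) (.singleton _)]
    have hpi : Measure.pi (fun i => observedCount p (M i)) {z} =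
        ENNReal.ofReal (p ^ k * (1 - p) ^ (n - k)) *
          ∏ i ∈ s, poissonMeasure (M i).toNNReal {z i - 1} := by
      rw [Measure.pi_singleton, ← Finset.prod_mul_prod_compl s]
      have h1 : ∏ i ∈ s, observedCount p (M i) {z i} =
          ENNReal.ofReal p ^ k * ∏ i ∈ s, poissonMeasure (M i).toNNReal {z i - 1} := by
        rw [← hsk, ← Finset.prod_const, ← Finset.prod_mul_distrib]
        refine Finset.prod_congr rfl fun i hi => ?_
        have h4 : z i ≠ 0 := by simpa [hs] using hi
        rw [← observedCount_succ, Nat.sub_add_cancel (Nat.one_le_iff_ne_zero.2 h4)]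
      have h2 : ∏ i ∈ sᶜ, observedCount p (M i) {z i} = ENNReal.ofReal (1 - p) ^ (n - k) := by
        rw [← hsk, hn, ← Finset.card_compl, ← Finset.prod_const]
        refine Finset.prod_congr rfl fun i hi => ?_
        have h4 : z i = 0 := by simpa [hs] using hi
        rw [h4, observedCount_zero]
      rw [h1, h2, ENNReal.ofReal_mul (by positivity), ENNReal.ofReal_pow hp0,
        ENNReal.ofReal_pow (by linarith)]
      ring
    rw [hsub, ← cond_mul_eq_inter (hX.measurableSet_fiber s), hcond, hfib, hpi, mul_comm,
      ← mul_assoc]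
    gcongr
    rw [← ENNReal.ofReal_natCast, ← ENNReal.ofReal_mul (by positivity)]
    refine ENNReal.ofReal_le_ofReal ?_
    have hc : (0 : ℝ) < n.choose k := by exact_mod_cast Nat.choose_pos hk
    rw [div_le_iff₀ hc]
    refine (one_le_mul_binomial_mode hcard hk).trans_eq ?_
    push_cast
    ring
  rw [← Measure.map_apply hZ (Set.to_countable B).measurableSet,
    ← Measure.tsum_indicator_apply_singleton _ B (Set.to_countable B).measurableSet,
    ← Measure.tsum_indicator_apply_singleton _ B (Set.to_countable B).measurableSet,
    ← ENNReal.tsum_mul_left]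
  refine ENNReal.tsum_le_tsum fun z => ?_
  by_cases hz : z ∈ B
  · simp only [Set.indicator_of_mem hz]
    rw [Measure.map_apply hZ (.singleton _)]
    exact hsing z
  · simp [hz]

end Sampling

/-! ### Moment estimates, tail bound and error bound. -/

section Deviation

open scoped ENNReal

/-- The weight `contribution (1 / β) (-1)` is `x / β + 1` at an observed count `x` and `0` without
observation: it is a Lipschitz constant of the likelihood in one tensor entry. -/
theorem contribution_zero_le {β : ℝ} (hβ : 0 < β) (z : ℕ) : 0 ≤ contribution (1 / β) (-1) z := by
  cases z with
  | zero => exact le_rfl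
  | succ x =>
    have : 0 ≤ (x : ℝ) * (1 / β) := by positivity
    simp only [contribution]
    linarith

theorem abs_contribution_le {β a c δ : ℝ} (ha : |a| ≤ 1 / β * |δ|) (hc : |c| ≤ |δ|) (z : ℕ) :
    |contribution a c z| ≤ contribution (1 / β) (-1) z * |δ| := by
  cases z with
  | zero => simp [contribution]
  | succ x =>
    simp only [contribution]
    calc |(x : ℝ) * a - c| ≤ |(x : ℝ) * a| + |c| := abs_sub _ _
      _ = x * |a| + |c| := by rw [abs_mul, Nat.abs_cast]
      _ ≤ x * (1 / β * |δ|) + |δ| := by gcongr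
      _ = _ := by ring

theorem contribution_sub (a c a' c' : ℝ) (z : ℕ) :
    contribution a c z - contribution a' c' z = contribution (a - a') (c - c') z := by
  cases z with
  | zero => simp [contribution]
  | succ x => simp only [contribution]; ring

theorem abs_log_sub_log_le {β s t : ℝ} (hβ : 0 < β) (hs : β ≤ s) (ht : β ≤ t) :
    |Real.log s - Real.log t| ≤ 1 / β * |s - t| := by
  have key {s t : ℝ} (hs : β ≤ s) (ht : β ≤ t) :
      Real.log s - Real.log t ≤ 1 / β * |s - t| := by
    have hs0 := hβ.trans_le hs
    have ht0 := hβ.trans_le ht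
    rw [← Real.log_div hs0.ne' ht0.ne']
    calc Real.log (s / t) ≤ s / t - 1 := Real.log_le_sub_one_of_pos (by positivity)
      _ = 1 / t * (s - t) := by field_simp
      _ ≤ 1 / t * |s - t| := by gcongr; exact le_abs_self _
      _ ≤ _ := by gcongr
  refine abs_le.2 ⟨?_, key hs ht⟩
  have := key ht hs
  rw [abs_sub_comm] at this
  linarith

/-- The Kullback–Leibler divergence of two Poisson distributions with means in `(0, α]` is at
least quadratic in the difference of the means. -/
theorem mul_log_sub_log_sub_le {α m t : ℝ} (hm : 0 < m) (ht : 0 < t) (hmα : m ≤ α) (htα : t ≤ α) :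
    m * (Real.log t - Real.log m) - (t - m) ≤ -((t - m) ^ 2 / (4 * α)) := by
  -- With square roots `r`, `s`, the bound `log (r / s) ≤ r / s - 1` makes the left side at most
  -- `-(r - s)²`, and `(r + s)² ≤ 4α` converts this to means.
  obtain ⟨r, hr, rfl⟩ : ∃ r : ℝ, 0 < r ∧ r ^ 2 = t := ⟨√t, Real.sqrt_pos.2 ht, Real.sq_sqrt ht.le⟩
  obtain ⟨s, hs, rfl⟩ : ∃ s : ℝ, 0 < s ∧ s ^ 2 = m := ⟨√m, Real.sqrt_pos.2 hm, Real.sq_sqrt hm.le⟩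
  have h1 : Real.log (r / s) ≤ r / s - 1 := Real.log_le_sub_one_of_pos (by positivity)
  have h2 : s ^ 2 * (r / s - 1) = s * r - s ^ 2 := by field_simp
  have h3 : (r ^ 2 - s ^ 2) ^ 2 / (4 * α) ≤ (r - s) ^ 2 := by
    rw [div_le_iff₀ (by linarith), show (r ^ 2 - s ^ 2) ^ 2 = (r - s) ^ 2 * (r + s) ^ 2 by ring]
    gcongr
    nlinarith [sq_nonneg (r - s)]
  have h4 := mul_le_mul_of_nonneg_left h1 (sq_nonneg s)
  rw [Real.log_div hr.ne' hs.ne'] at h4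
  rw [Real.log_pow, Real.log_pow]
  push_cast
  nlinarith

/-- The two independent copies produce the squares, the fair sign their average. -/
theorem lintegral_exp_signedSum {A : Type*} [MeasurableSpace A] [Countable A]
    [MeasurableSingletonClass A] (κ : Measure A) [IsProbabilityMeasure κ] (w : A → ℝ) (q : ℝ) :
    ∫⁻ y, ENNReal.ofReal (Real.exp (q * signedSum w y)) ∂symmetrized κ =
      2⁻¹ * ((∫⁻ a, ENNReal.ofReal (Real.exp (q * w a)) ∂κ) ^ 2 +
        (∫⁻ a, ENNReal.ofReal (Real.exp (-q * w a)) ∂κ) ^ 2) := by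
  have hsq (q : ℝ) : ∫⁻ a, ∫⁻ a', ENNReal.ofReal (Real.exp (q * w a + q * w a')) ∂κ ∂κ =
      (∫⁻ a, ENNReal.ofReal (Real.exp (q * w a)) ∂κ) ^ 2 := by
    have h (a a') : ENNReal.ofReal (Real.exp (q * w a + q * w a')) =
        ENNReal.ofReal (Real.exp (q * w a)) * ENNReal.ofReal (Real.exp (q * w a')) := by
      rw [Real.exp_add, ENNReal.ofReal_mul (Real.exp_pos _).le]
    simp_rw [h]
    rw [sq, ← lintegral_mul_const _ Measurable.of_discrete]
    exact lintegral_congr fun a => lintegral_const_mul _ Measurable.of_discrete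
  rw [lintegral_symmetrized, ← hsq, ← hsq, ← lintegral_add_left Measurable.of_discrete,
    ← lintegral_const_mul _ Measurable.of_discrete]
  refine lintegral_congr fun a => ?_
  rw [← lintegral_add_left Measurable.of_discrete, ← lintegral_const_mul _ Measurable.of_discrete]
  refine lintegral_congr fun a' => ?_
  simp only [signedSum, boolSign, if_true, Bool.false_eq_true, if_false]
  ring_nf

/-- The sign makes the first-order terms of `u` and `v` nearly cancel. The rest is of order `p * τ ^
2`, with the factor `p` kept because only a fraction `p` of the entries contributes. -/
theorem half_sq_add_sq_le_exp_of_abs_le {u v τ p : ℝ} (hτ0 : 0 ≤ τ) (hτ : τ ≤ 1 / 100)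
    (hp0 : 0 ≤ p) (hp1 : p ≤ 1) (hu : |u| ≤ 2.01 * τ) (hv : |v| ≤ 2.01 * τ)
    (huv : u + v ≤ 2 * τ ^ 2) :
    2⁻¹ * ((1 - p + p * Real.exp u) ^ 2 + (1 - p + p * Real.exp v) ^ 2) ≤
      Real.exp (20 * (p * τ ^ 2)) := by
  have hτ2 : τ ^ 2 ≤ 1 / 100 * τ := by
    rw [sq]
    exact mul_le_mul_of_nonneg_right hτ hτ0
  have hexp {z : ℝ} (hz : |z| ≤ 2.01 * τ) :
      Real.exp z - 1 ≤ z + 4.05 * τ ^ 2 ∧ (Real.exp z - 1) ^ 2 ≤ 5 * τ ^ 2 := by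
    have h1 : z ^ 2 ≤ 4.05 * τ ^ 2 := by
      calc z ^ 2 ≤ (2.01 * τ) ^ 2 := sq_le_sq' (abs_le.1 hz).1 (abs_le.1 hz).2
        _ ≤ _ := by rw [mul_pow]; gcongr; norm_num
    have h2 := abs_le.1 (Real.abs_exp_sub_one_sub_id_le (x := z) (by linarith))
    have h3 := abs_le.1 hz
    refine ⟨by linarith [h2.2], ?_⟩
    calc (Real.exp z - 1) ^ 2 ≤ (2.1 * τ) ^ 2 :=
          sq_le_sq' (by linarith [h2.1, h3.1]) (by linarith [h2.2, h3.2])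
      _ ≤ _ := by rw [mul_pow]; gcongr; norm_num
  obtain ⟨hU, hU2⟩ := hexp hu
  obtain ⟨hV, hV2⟩ := hexp hv
  have h1 : p * ((Real.exp u - 1) + (Real.exp v - 1)) ≤ p * (10.1 * τ ^ 2) := by
    gcongr
    linarith
  have h2 : p ^ 2 * ((Real.exp u - 1) ^ 2 + (Real.exp v - 1) ^ 2) ≤ p * (10 * τ ^ 2) :=
    mul_le_mul (by rw [sq]; exact mul_le_of_le_one_left hp0 hp1) (by linarith) (by positivity) hp0
  have h3 : 0 ≤ p * τ ^ 2 := by positivity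
  have h4 := Real.add_one_le_exp (20 * (p * τ ^ 2))
  have h5 : 2⁻¹ * ((1 - p + p * Real.exp u) ^ 2 + (1 - p + p * Real.exp v) ^ 2) =
      1 + p * ((Real.exp u - 1) + (Real.exp v - 1)) +
        2⁻¹ * (p ^ 2 * ((Real.exp u - 1) ^ 2 + (Real.exp v - 1) ^ 2)) := by ring
  rw [h5]
  linarith

theorem half_sq_add_sq_le_exp {β α m b τ p : ℝ} (hβ : 0 < β) (hβm : β ≤ m) (hmα : m ≤ α)
    (hτ0 : 0 ≤ τ) (hτ : τ ≤ 1 / 100) (hb : b = τ / (α + 1)) (hp0 : 0 ≤ p) (hp1 : p ≤ 1) :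
    2⁻¹ * ((1 - p + p * Real.exp (b * β + m * (Real.exp b - 1))) ^ 2 +
      (1 - p + p * Real.exp (-b * β + m * (Real.exp (-b) - 1))) ^ 2) ≤
        Real.exp (20 * (p * τ ^ 2)) := by
  have hm : 0 < m := hβ.trans_le hβm
  have hα : 0 < α := hm.trans_le hmα
  have hb0 : 0 ≤ b := by rw [hb]; positivity
  have hbτ : b * (α + 1) = τ := by rw [hb]; field_simp
  -- Dividing `τ` by `α + 1` makes `b`, `b * m` and `b * β` all at most `τ`.
  have hb1 : b ≤ τ := by
    rw [← hbτ]
    exact le_mul_of_one_le_right hb0 (by linarith)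
  have hbm : b * m ≤ τ := by
    rw [← hbτ]
    gcongr
    linarith
  have hbβ : b * β ≤ τ := le_trans (by gcongr) hbm
  have hbm0 : 0 ≤ b * m := by positivity
  have hbβ0 : 0 ≤ b * β := by positivity
  have hτ2 : τ ^ 2 ≤ 1 / 100 * τ := by
    rw [sq]
    exact mul_le_mul_of_nonneg_right hτ hτ0
  have hmb2 : m * b ^ 2 ≤ τ ^ 2 := by
    calc m * b ^ 2 = (b * m) * b := by ring
      _ ≤ τ * τ := mul_le_mul hbm hb1 hb0 hτ0
      _ = τ ^ 2 := (sq τ).symm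
  have hexp {z : ℝ} (hz : |z| ≤ 1) :
      m * z ≤ m * (Real.exp z - 1) ∧ m * (Real.exp z - 1) ≤ m * z + m * z ^ 2 := by
    have h1 := (abs_le.1 (Real.abs_exp_sub_one_sub_id_le hz)).2
    have h2 := Real.add_one_le_exp z
    rw [← mul_add]
    constructor <;> gcongr <;> linarith
  have hb' : |b| ≤ 1 := by rw [abs_of_nonneg hb0]; linarith
  obtain ⟨hx1, hx2⟩ := hexp hb'
  obtain ⟨hy1, hy2⟩ := hexp ((abs_neg b).trans_le hb')
  rw [neg_sq] at hy2
  refine half_sq_add_sq_le_exp_of_abs_le hτ0 hτ hp0 hp1 (abs_le.2 ⟨?_, ?_⟩) (abs_le.2 ⟨?_, ?_⟩) ?_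
    <;> linarith

theorem lintegral_exp_contribution {p m β : ℝ} (hp0 : 0 ≤ p) (hp1 : p ≤ 1) (hm : 0 ≤ m)
    (hβ : 0 < β) (s : ℝ) :
    ∫⁻ z, ENNReal.ofReal (Real.exp (s * (β * contribution (1 / β) (-1) z))) ∂observedCount p m =
      ENNReal.ofReal (1 - p + p * Real.exp (s * β + m * (Real.exp s - 1))) := by
  have h (x : ℕ) : ENNReal.ofReal (Real.exp (s * (β * contribution (1 / β) (-1) (x + 1)))) =
      ENNReal.ofReal (Real.exp (s * β)) * ENNReal.ofReal (Real.exp (s * x)) := by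
    rw [← ENNReal.ofReal_mul (Real.exp_pos _).le, ← Real.exp_add]
    congr 2
    simp only [contribution]
    field_simp
    ring
  rw [lintegral_observedCount]
  simp_rw [h]
  rw [lintegral_const_mul _ Measurable.of_discrete, lintegral_exp_poissonMeasure hm,
    ← ENNReal.ofReal_mul (Real.exp_pos _).le, ← Real.exp_add, ← ENNReal.ofReal_mul hp0]
  simp only [contribution, mul_zero, Real.exp_zero, ENNReal.ofReal_one, mul_one]
  rw [← ENNReal.ofReal_add (by linarith) (by positivity)]

variable {N : ℕ} {I : Fin N → ℕ}

/-- Bound the supremum by the sum over all sign tensors and both signs `±C`. Each summand factors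
over the entries, and since the signed sums are symmetric in law, every factor is the same as for
the constant `C`. -/
theorem lintegral_iSup_exp_signedSum_le {J A : Type*} [MeasurableSpace A] [Countable A]
    [MeasurableSingletonClass A] (κ : MultiIndex I → Measure A) [∀ i, IsProbabilityMeasure (κ i)]
    (w : MultiIndex I → A → ℝ) (d : MultiIndex I → J → ℝ) {C : ℝ}
    (hd : ∀ T, CubeBounded C (fun i => d i T)) {g : ℝ≥0∞}
    (hg : ∀ i, 2⁻¹ * ((∫⁻ a, ENNReal.ofReal (Real.exp (C * w i a)) ∂κ i) ^ 2 +
        (∫⁻ a, ENNReal.ofReal (Real.exp (-C * w i a)) ∂κ i) ^ 2) ≤ g) :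
    ∫⁻ y, ⨆ T, ENNReal.ofReal (Real.exp (∑ i, signedSum (w i) (y i) * d i T))
        ∂Measure.pi (fun i => symmetrized (κ i)) ≤
      2 * 2 ^ (∑ n, I n) * g ^ Fintype.card (MultiIndex I) := by
  let F (σ : (n : Fin N) → Fin (I n) → Bool) (q : ℝ) (y : MultiIndex I → A × A × Bool) : ℝ≥0∞ :=
    ∏ i, ENNReal.ofReal (Real.exp (q * signTensor σ i * signedSum (w i) (y i)))
  have hF (σ) (q : ℝ) (hq : q = C ∨ q = -C) :
      ∫⁻ y, F σ q y ∂Measure.pi (fun i => symmetrized (κ i)) ≤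
        g ^ Fintype.card (MultiIndex I) := by
    rw [lintegral_pi_prod (fun i => symmetrized (κ i))
      (fun i y => ENNReal.ofReal (Real.exp (q * signTensor σ i * signedSum (w i) y)))
      fun i => Measurable.of_discrete]
    refine Finset.prod_le_pow_card _ _ _ fun i _ => ?_
    rw [lintegral_exp_signedSum]
    refine le_trans (le_of_eq ?_) (hg i)
    have hq' : q * signTensor σ i = C ∨ q * signTensor σ i = -C := by
      rcases hq with rfl | rfl <;>
        rcases eq_or_eq_neg_of_abs_eq (abs_signTensor σ i) with h | h <;> simp [h]
    rcases hq' with h | h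
    · rw [h]
    · rw [h, neg_neg, add_comm]
  have hpoint (y) : ⨆ T, ENNReal.ofReal (Real.exp (∑ i, signedSum (w i) (y i) * d i T)) ≤
      ∑ σ, (F σ C y + F σ (-C) y) := by
    refine iSup_le fun T => ?_
    obtain ⟨σ, hσ⟩ := (hd T).exists_signTensor fun i => signedSum (w i) (y i)
    refine le_trans ?_ (Finset.single_le_sum (f := fun σ => F σ C y + F σ (-C) y)
      (fun _ _ => zero_le) (Finset.mem_univ σ))
    have hFe (q : ℝ) : F σ q y = ENNReal.ofReal (Real.exp
        (q * ∑ i, signedSum (w i) (y i) * signTensor σ i)) := by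
      rw [Finset.mul_sum, ofReal_exp_sum]
      refine Finset.prod_congr rfl fun i _ => ?_
      ring_nf
    rw [hFe, hFe]
    rcases abs_cases (∑ i, signedSum (w i) (y i) * signTensor σ i) with ⟨h, _⟩ | ⟨h, _⟩
    · refine le_trans (ENNReal.ofReal_le_ofReal (Real.exp_le_exp.2 ?_)) le_self_add
      rwa [h] at hσ
    · refine le_trans (ENNReal.ofReal_le_ofReal (Real.exp_le_exp.2 ?_)) le_add_self
      rw [h] at hσ
      linarith
  calc _ ≤ ∫⁻ y, ∑ σ, (F σ C y + F σ (-C) y) ∂Measure.pi (fun i => symmetrized (κ i)) :=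
        lintegral_mono hpoint
    _ = ∑ σ, (∫⁻ y, F σ C y ∂Measure.pi (fun i => symmetrized (κ i)) +
          ∫⁻ y, F σ (-C) y ∂Measure.pi (fun i => symmetrized (κ i))) := by
        rw [lintegral_finsetSum _ fun _ _ => Measurable.of_discrete]
        exact Finset.sum_congr rfl fun σ _ => lintegral_add_left Measurable.of_discrete _
    _ ≤ ∑ _σ : (n : Fin N) → Fin (I n) → Bool, 2 * g ^ Fintype.card (MultiIndex I) := by
        refine Finset.sum_le_sum fun σ _ => ?_
        rw [two_mul]
        exact add_le_add (hF σ C (Or.inl rfl)) (hF σ (-C) (Or.inr rfl))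
    _ = _ := by
        rw [Finset.sum_const, Finset.card_univ, Fintype.card_pi]
        simp only [Fintype.card_fun, Fintype.card_bool, Fintype.card_fin, nsmul_eq_mul]
        rw [Finset.prod_pow_eq_pow_sum]
        push_cast
        ring

/-- For independently observed entries, it is unlikely that some tensor far from `M` has at least
the likelihood of `M`. -/
theorem measure_pi_exists_likelihood_ge_le {J : Type*} (t : J → RealTensor I) (M : RealTensor I)
    {β α C τ p Θ : ℝ} (hβ : 0 < β) (hC : 0 < C) (hM : ∀ i, β ≤ M i ∧ M i ≤ α)
    (ht : ∀ T i, β ≤ t T i ∧ t T i ≤ α) (hα : 0 < α)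
    (hcube : ∀ T, CubeBounded (C * α) (fun i => t T i - M i))
    (hfar : ∀ T, Θ ≤ ∑ i, (t T i - M i) ^ 2)
    (hτ0 : 0 ≤ τ) (hτ : τ ≤ 1 / 100) (hp0 : 0 ≤ p) (hp1 : p ≤ 1) :
    Measure.pi (fun i => observedCount p (M i)) {z | ∃ T, 0 ≤ ∑ i,
        contribution (Real.log (t T i) - Real.log (M i)) (t T i - M i) (z i)} ≤
      ENNReal.ofReal (2 * 2 ^ (∑ n, I n) * Real.exp (20 * (p * τ ^ 2)) ^
        Fintype.card (MultiIndex I) *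
          Real.exp (-(τ / (α + 1) * β / (C * α) * (p * (Θ / (4 * α)))))) := by
  have hprob (i) := isProbabilityMeasure_observedCount hp0 hp1 (M i)
  set b := τ / (α + 1) with hb
  have hb0 : 0 ≤ b := by positivity
  -- This scale cancels the hull constant `C * α` and turns the weight `x / β + 1` into `b * (x +
  -- β)`, whose moments are explicit.
  set l := b * β / (C * α) with hl
  have hl0 : 0 ≤ l := by positivity
  set θ := l * (p * (Θ / (4 * α))) with hθ
  let ψ (i : MultiIndex I) (z : ℕ) (T : J) : ℝ :=
    l * contribution (Real.log (t T i) - Real.log (M i)) (t T i - M i) z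
  let w (i : MultiIndex I) (z : ℕ) : ℝ := l * contribution (1 / β) (-1) z
  let d (i : MultiIndex I) (T : J) : ℝ := t T i - M i
  have hM0 (i) : 0 ≤ M i := hβ.le.trans (hM i).1
  have hψint (i) (T) : ∫ z, ψ i z T ∂observedCount p (M i) ≤
      -(l * (p * ((t T i - M i) ^ 2 / (4 * α)))) := by
    simp only [ψ]
    rw [integral_const_mul, integral_contribution hp0 (hM0 i), ← mul_neg, ← mul_neg]
    gcongr
    exact mul_log_sub_log_sub_le (hβ.trans_le (hM i).1) (hβ.trans_le (ht T i).1) (hM i).2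
      (ht T i).2
  have hcontr := lintegral_pi_iSup_exp_le_symmetrized (fun i => observedCount p (M i)) d ψ w
    (fun i z => mul_nonneg hl0 (contribution_zero_le hβ z))
    (fun i z T => by
      simp only [ψ, w, d]
      rw [abs_mul, abs_of_nonneg hl0, mul_assoc]
      gcongr
      exact abs_contribution_le (abs_log_sub_log_le hβ (ht T i).1 (hM i).1) le_rfl z)
    (fun i z T T' => by
      simp only [ψ, w, d]
      rw [← mul_sub, abs_mul, abs_of_nonneg hl0, mul_assoc, contribution_sub]
      gcongr
      rw [sub_sub_sub_cancel_right, sub_sub_sub_cancel_right]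
      exact abs_contribution_le (abs_log_sub_log_le hβ (ht T i).1 (ht T' i).1) le_rfl z)
    (fun i T => (integrable_contribution (hM0 i) _ _).const_mul _)
  have hwl (q : ℝ) (z : ℕ) : q * C * α * (l * contribution (1 / β) (-1) z) =
      (q * b) * (β * contribution (1 / β) (-1) z) := by
    rw [hl]; field_simp
  have hsup := lintegral_iSup_exp_signedSum_le (fun i => observedCount p (M i)) w d hcube
    (g := ENNReal.ofReal (Real.exp (20 * (p * τ ^ 2)))) (fun i => by
      have h1 (z : ℕ) : C * α * w i z = b * (β * contribution (1 / β) (-1) z) := by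
        have := hwl 1 z
        rwa [one_mul, one_mul] at this
      have h2 (z : ℕ) : -(C * α) * w i z = -b * (β * contribution (1 / β) (-1) z) := by
        have := hwl (-1) z
        rwa [neg_one_mul, neg_mul, neg_one_mul] at this
      simp_rw [h1, h2]
      rw [lintegral_exp_contribution hp0 hp1 (hM0 i) hβ,
        lintegral_exp_contribution hp0 hp1 (hM0 i) hβ]
      have hpos (x : ℝ) : 0 ≤ 1 - p + p * Real.exp x := by
        have := mul_nonneg hp0 (Real.exp_pos x).le
        linarith
      rw [← ENNReal.ofReal_pow (hpos _), ← ENNReal.ofReal_pow (hpos _),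
        ← ENNReal.ofReal_add (sq_nonneg _) (sq_nonneg _),
        show (2⁻¹ : ℝ≥0∞) = ENNReal.ofReal 2⁻¹ by
          rw [ENNReal.ofReal_inv_of_pos two_pos]; simp,
        ← ENNReal.ofReal_mul (by positivity)]
      exact ENNReal.ofReal_le_ofReal
        (half_sq_add_sq_le_exp hβ (hM i).1 (hM i).2 hτ0 hτ hb hp0 hp1))
  set f : (MultiIndex I → ℕ) → ℝ≥0∞ := fun x => ⨆ T, ENNReal.ofReal (Real.exp
    (∑ i, (ψ i (x i) T - ∫ a, ψ i a T ∂observedCount p (M i)))) with hf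
  have hsub : {z | ∃ T, 0 ≤ ∑ i, contribution (Real.log (t T i) - Real.log (M i))
      (t T i - M i) (z i)} ⊆ {z : MultiIndex I → ℕ | ENNReal.ofReal (Real.exp θ) ≤ f z} := by
    rintro z ⟨T, hT⟩
    refine le_trans (ENNReal.ofReal_le_ofReal (Real.exp_le_exp.2 ?_)) (le_iSup
      (fun T => ENNReal.ofReal (Real.exp (∑ i, (ψ i (z i) T -
        ∫ a, ψ i a T ∂observedCount p (M i))))) T)
    rw [Finset.sum_sub_distrib]
    have h1 : 0 ≤ ∑ i, ψ i (z i) T := by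
      simp only [ψ]
      rw [← Finset.mul_sum]
      exact mul_nonneg hl0 hT
    -- The mean is at most `-θ`, so on the event the centered sum is at least `θ` and Markov's
    -- inequality costs `exp (-θ)`.
    have h2 : ∑ i, ∫ a, ψ i a T ∂observedCount p (M i) ≤ -θ := by
      refine (Finset.sum_le_sum fun i _ => hψint i T).trans ?_
      rw [Finset.sum_neg_distrib, ← Finset.mul_sum, ← Finset.mul_sum, ← Finset.sum_div, hθ]
      have := hfar T
      gcongr
    linarith
  have hmarkov := mul_meas_ge_le_lintegral (μ := Measure.pi fun i => observedCount p (M i))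
    (f := f) Measurable.of_discrete (ENNReal.ofReal (Real.exp θ))
  refine (measure_mono hsub).trans ?_
  have hone : ENNReal.ofReal (Real.exp (-θ)) * ENNReal.ofReal (Real.exp θ) = 1 := by
    rw [← ENNReal.ofReal_mul (Real.exp_pos _).le, ← Real.exp_add]
    simp
  calc _ = ENNReal.ofReal (Real.exp (-θ)) * (ENNReal.ofReal (Real.exp θ) *
          Measure.pi (fun i => observedCount p (M i))
            {z : MultiIndex I → ℕ | ENNReal.ofReal (Real.exp θ) ≤ f z}) := by
        rw [← mul_assoc, hone, one_mul]
    _ ≤ ENNReal.ofReal (Real.exp (-θ)) * (2 * 2 ^ (∑ n, I n) *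
          ENNReal.ofReal (Real.exp (20 * (p * τ ^ 2))) ^ Fintype.card (MultiIndex I)) :=
        mul_le_mul_right (hmarkov.trans (hcontr.trans hsup)) _
    _ = _ := by
        rw [ENNReal.ofReal_mul (by positivity), ENNReal.ofReal_mul (by positivity),
          ENNReal.ofReal_pow (Real.exp_pos _).le, ENNReal.ofReal_mul (by positivity),
          ENNReal.ofReal_pow (by positivity), mul_comm]
        simp

theorem norm_sub_sq_div_norm_sq_le [Nonempty (MultiIndex I)] {β α : ℝ} (hβ : 0 < β)
    {M T : RealTensor I} (hM : ∀ i, β ≤ M i ∧ M i ≤ α) (hT : ∀ i, β ≤ T i ∧ T i ≤ α) :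
    ‖M - T‖ ^ 2 / ‖M‖ ^ 2 ≤ α ^ 2 / β ^ 2 := by
  have hn : (0 : ℝ) < Fintype.card (MultiIndex I) := by exact_mod_cast Fintype.card_pos
  have h1 : ‖M - T‖ ^ 2 ≤ Fintype.card (MultiIndex I) * α ^ 2 := by
    rw [EuclideanSpace.real_norm_sq_eq]
    refine (Finset.sum_le_card_nsmul _ _ (α ^ 2) fun i _ => ?_).trans_eq (by simp)
    have := hM i
    have := hT i
    refine sq_le_sq' ?_ ?_ <;> simp only [PiLp.sub_apply] <;> linarith
  have h2 : Fintype.card (MultiIndex I) * β ^ 2 ≤ ‖M‖ ^ 2 := by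
    rw [EuclideanSpace.real_norm_sq_eq]
    refine le_trans (le_of_eq (by simp)) (Finset.card_nsmul_le_sum Finset.univ _ (β ^ 2)
      fun i _ => ?_)
    have := (hM i).1
    gcongr
  calc _ ≤ (Fintype.card (MultiIndex I) * α ^ 2) / (Fintype.card (MultiIndex I) * β ^ 2) := by
        gcongr
    _ = _ := by field_simp

theorem five_mul_le_add_logb {α : ℝ} (hα : 0 ≤ α) {k : ℕ} (hk : 1 ≤ k) :
    5 * α ≤ α * (Real.exp 2 - 2) + 3 * Real.logb 2 (k : ℝ) := by
  have h1 : 0 ≤ Real.logb 2 (k : ℝ) :=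
    Real.logb_nonneg one_lt_two (by exact_mod_cast hk)
  have h2 : 7 ≤ Real.exp 2 := by
    have := Real.exp_one_gt_d9
    rw [show (2 : ℝ) = 1 + 1 by norm_num, Real.exp_add]
    nlinarith
  nlinarith

theorem two_pow_le_exp (D : ℕ) : (2 : ℝ) ^ D ≤ Real.exp D := by
  have h := Real.add_one_le_exp 1
  rw [← mul_one (D : ℝ), Real.exp_nat_mul]
  gcongr
  linarith

theorem card_multiIndex_le : Fintype.card (MultiIndex I) ≤ 2 ^ (∑ n, I n) := by
  rw [Fintype.card_pi, ← Finset.prod_pow_eq_pow_sum]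
  refine Finset.prod_le_prod' fun n _ => ?_
  rw [Fintype.card_fin]
  exact Nat.lt_two_pow_self.le

/-- Common core of both parts: the kind of rank enters only through the hull constant `C`. -/
theorem IsPoissonSampling.one_sub_lt_measureReal {Λ : Type*} [MeasurableSpace Λ] {P : Measure Λ}
    [IsProbabilityMeasure P] {M : RealTensor I} {k : ℕ} {Ω : Λ → Finset (MultiIndex I)}
    {X : Λ → MultiIndex I → ℕ} (hX : IsPoissonSampling P M k Ω X) (hN : 1 ≤ N)
    (hI : ∀ n, 0 < I n) (hk : 1 ≤ k) (hkI : k ≤ ∏ n, I n) {β α C : ℝ} (hβ : 0 < β) (hβα : β ≤ α)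
    (hM : ∀ i, β ≤ M i ∧ M i ≤ α) (hC : 1 ≤ C) (S : Set (RealTensor I))
    (hS : ∀ T ∈ S, ∀ i, β ≤ T i ∧ T i ≤ α)
    (hcube : ∀ T ∈ S, CubeBounded (C * α) (fun i => T i - M i)) :
    1 - 2 / (k : ℝ) < P.real {w | ∀ T ∈ S,
      poissonLogLik (Ω w) (X w) M ≤ poissonLogLik (Ω w) (X w) T →
      ‖M - T‖ ^ 2 / ‖M‖ ^ 2 ≤
        128 * α * (α + 1) / β ^ 3 * (α * (Real.exp 2 - 2) + 3 * Real.logb 2 (k : ℝ)) *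
          (C * (√(∑ n, (I n : ℝ)) / √(k : ℝ)))} := by
  have hα : 0 < α := hβ.trans_le hβα
  have hk0 : (0 : ℝ) < k := by exact_mod_cast hk
  have hne : Nonempty (MultiIndex I) := ⟨fun n => ⟨0, hI n⟩⟩
  set L := α * (Real.exp 2 - 2) + 3 * Real.logb 2 (k : ℝ) with hL
  have hL5 : 5 * α ≤ L := five_mul_le_add_logb hα.le hk
  set n := Fintype.card (MultiIndex I) with hn
  have hnprod : n = ∏ n, I n := by simp [hn]
  have hkn : k ≤ n := hnprod ▸ hkI
  have hn0 : 0 < n := Fintype.card_pos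
  have hn0' : (0 : ℝ) < n := by exact_mod_cast hn0
  set D := ∑ n, I n with hD
  have hD1 : 1 ≤ D := (hI ⟨0, hN⟩).trans_le (Finset.single_le_sum (f := I)
    (fun _ _ => Nat.zero_le _) (Finset.mem_univ _))
  have hD1' : (1 : ℝ) ≤ D := by exact_mod_cast hD1
  rw [show ∑ n, (I n : ℝ) = D by rw [hD]; push_cast; rfl]
  set τ := √(D : ℝ) / √(k : ℝ) with hτ
  have hτ0 : 0 ≤ τ := by positivity
  have hτ2 : k * τ ^ 2 = D := by
    rw [hτ, div_pow, Real.sq_sqrt (by positivity), Real.sq_sqrt (by positivity)]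
    field_simp
  set E := 128 * α * (α + 1) / β ^ 3 * L * (C * τ) with hE
  have hL0 : 0 ≤ L := le_trans (by positivity) hL5
  have hE0 : 0 ≤ E := by positivity
  rcases le_total (1 / 100) (C * τ) with hbig | hsmall
  -- Here `128 * 5 / 100 ≥ 1`, so the right side exceeds the trivial bound `α² / β²` for every
  -- outcome.
  · have hall : {w | ∀ T ∈ S, poissonLogLik (Ω w) (X w) M ≤ poissonLogLik (Ω w) (X w) T →
        ‖M - T‖ ^ 2 / ‖M‖ ^ 2 ≤ E} = Set.univ := by
      refine Set.eq_univ_of_forall fun w T hT _ => ?_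
      refine (norm_sub_sq_div_norm_sq_le hβ hM (hS T hT)).trans ?_
      calc α ^ 2 / β ^ 2 = α ^ 2 * β / β ^ 3 := by field_simp
        _ ≤ 128 * α * (α + 1) / β ^ 3 * (5 * α) * (1 / 100) := by
            rw [div_mul_eq_mul_div, div_mul_eq_mul_div]
            refine div_le_div_of_nonneg_right ?_ (by positivity)
            have : α ^ 2 * β ≤ α ^ 2 * (α + 1) := by gcongr; linarith
            have : 0 ≤ α ^ 2 * (α + 1) := by positivity
            nlinarith
        _ ≤ E := by rw [hE]; gcongr
    rw [hall, probReal_univ]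
    have : 0 < 2 / (k : ℝ) := by positivity
    linarith
  · have hτ1 : τ ≤ 1 / 100 := by nlinarith
    set p : ℝ := (k : ℝ) / n with hp
    have hp0 : 0 ≤ p := by positivity
    have hp1 : p ≤ 1 := div_le_one_of_le₀ (by exact_mod_cast hkn) (by positivity)
    -- The tensors violating the bound belong to `J`, because `n * β ^ 2 ≤ ‖M‖ ^ 2`.
    let J := {T : RealTensor I // T ∈ S ∧ E * (n * β ^ 2) ≤ ∑ i, (T i - M i) ^ 2}
    have htail := measure_pi_exists_likelihood_ge_le (J := J) (fun T => T.1) M hβ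
      (by linarith : 0 < C) hM (fun T => hS T.1 T.2.1) hα (fun T => hcube T.1 T.2.1)
      (fun T => T.2.2) hτ0 hτ1 hp0 hp1
    set B : Set (MultiIndex I → ℕ) := {z | ∃ T : J, 0 ≤ ∑ i,
        contribution (Real.log (T.1 i) - Real.log (M i)) (T.1 i - M i) (z i)} with hB
    have hdom := hX.measure_preimage_observedCode_le hn0 hkn B
    have hexponent : τ / (α + 1) * β / (C * α) * (p * (E * (n * β ^ 2) / (4 * α))) =
        32 * D * (L / α) := by
      rw [hE, hp, ← hτ2]
      field_simp
      ring
    have hexp20 : Real.exp (20 * (p * τ ^ 2)) ^ n = Real.exp (20 * D) := by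
      rw [← Real.exp_nat_mul, hp, ← hτ2]
      congr 1
      field_simp
    rw [← hn, ← hD, hexponent, hexp20] at htail
    have hpow : (2 : ℝ) ^ D ≤ Real.exp D := two_pow_le_exp D
    have hnD : (n : ℝ) ≤ 2 ^ D := by exact_mod_cast card_multiIndex_le
    have h2D : (2 : ℝ) ≤ 2 ^ D := by simpa using pow_le_pow_right₀ one_le_two hD1
    have hkD : (k : ℝ) ≤ Real.exp D := (by exact_mod_cast hkn : (k : ℝ) ≤ n).trans (hnD.trans hpow)
    have hbound : P (observedCode Ω X ⁻¹' B) ≤ ENNReal.ofReal (1 / k) := by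
      refine hdom.trans ((mul_le_mul_right htail _).trans ?_)
      rw [← ENNReal.ofReal_natCast, ← ENNReal.ofReal_mul (by positivity)]
      refine ENNReal.ofReal_le_ofReal ?_
      have h160 : 160 * (D : ℝ) ≤ 32 * D * (L / α) := by
        have : 5 ≤ L / α := by rwa [le_div_iff₀ hα]
        nlinarith
      -- The factors `n + 1` and `2 * 2 ^ D` cost `exp (2 * D)` each and the moments `exp (20 * D)`,
      -- against a gain of at least `exp (160 * D)` from `L ≥ 5 * α`.
      calc ((n + 1 : ℕ) : ℝ) * (2 * 2 ^ D * Real.exp (20 * D) * Real.exp (-(32 * D * (L / α))))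
          ≤ (Real.exp D * Real.exp D) * (Real.exp D * Real.exp D * Real.exp (20 * D) *
              Real.exp (-(160 * D))) := by
            have : ((n + 1 : ℕ) : ℝ) ≤ Real.exp D * Real.exp D := by
              push_cast
              nlinarith
            gcongr
            linarith
        _ = Real.exp (-(136 * D)) := by
            simp only [← Real.exp_add]
            ring_nf
        _ ≤ Real.exp (-D) := Real.exp_le_exp.2 (by linarith)
        _ ≤ 1 / k := by
            rw [Real.exp_neg, ← one_div]
            gcongr
    have hmeas : MeasurableSet (observedCode Ω X ⁻¹' B) :=
      hX.measurable_observedCode (Set.to_countable B).measurableSet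
    have hsub : (observedCode Ω X ⁻¹' B)ᶜ ⊆ {w | ∀ T ∈ S,
        poissonLogLik (Ω w) (X w) M ≤ poissonLogLik (Ω w) (X w) T →
        ‖M - T‖ ^ 2 / ‖M‖ ^ 2 ≤ E} := by
      intro w hw T hT hlik
      by_contra! hcon
      refine hw ⟨⟨T, hT, ?_⟩, ?_⟩
      · have hMn : n * β ^ 2 ≤ ‖M‖ ^ 2 := by
          rw [EuclideanSpace.real_norm_sq_eq]
          refine le_trans (le_of_eq (by simp [hn])) (Finset.card_nsmul_le_sum Finset.univ _ (β ^ 2)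
            fun i _ => ?_)
          have := (hM i).1
          gcongr
        have hM0 : 0 < ‖M‖ ^ 2 := lt_of_lt_of_le (by positivity) hMn
        rw [lt_div_iff₀ hM0] at hcon
        have hd : ‖M - T‖ ^ 2 = ∑ i, (T i - M i) ^ 2 := by
          rw [norm_sub_rev, EuclideanSpace.real_norm_sq_eq]
          rfl
        rw [← hd]
        exact (mul_le_mul_of_nonneg_left hMn hE0).trans hcon.le
      · rw [← poissonLogLik_sub_eq_sum_contribution Ω X w T M]
        linarith
    have h1 : 1 - 1 / (k : ℝ) ≤ P.real (observedCode Ω X ⁻¹' B)ᶜ := by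
      rw [probReal_compl_eq_one_sub hmeas]
      have : P.real (observedCode Ω X ⁻¹' B) ≤ 1 / k :=
        ENNReal.toReal_le_of_le_ofReal (by positivity) hbound
      linarith
    have h2 := measureReal_mono (μ := P) hsub
    have h3 : 1 / (k : ℝ) < 2 / k := by gcongr; norm_num
    linarith

theorem one_le_of_mem_cpSpace (hI : ∀ n, 0 < I n) {R : ℕ} {β α : ℝ} (hβ : 0 < β)
    {T : RealTensor I} (hT : T ∈ cpSpace I R β α) : 1 ≤ R := by
  obtain ⟨R', hR', a, ha⟩ := exists_decomposition_of_cpRank_le hT.2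
  refine le_trans (Nat.one_le_iff_ne_zero.2 ?_) hR'
  rintro rfl
  let i : MultiIndex I := fun n => ⟨0, hI n⟩
  have h1 := ha i
  have h2 := (hT.1 i).1
  simp only [Finset.univ_eq_empty, Finset.sum_empty] at h1
  linarith

theorem nncpSpace_subset_cpSpace (R : ℕ) (β α : ℝ) : nncpSpace I R β α ⊆ cpSpace I R β α :=
  fun _ hT => ⟨hT.1, le_trans (iInf_mono fun _ => iInf_mono' fun ⟨a, ha⟩ => ⟨⟨a, ha.2⟩, le_rfl⟩)
    hT.2⟩

theorem pow_le_mul_sqrt_pow (R m : ℕ) : (R : ℝ) ^ m ≤ (R * √(R : ℝ)) ^ m := by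
  refine pow_le_pow_left₀ (by positivity) ?_ m
  rcases Nat.eq_zero_or_pos R with rfl | hR
  · simp
  · refine le_mul_of_one_le_right (by positivity) ?_
    rw [Real.one_le_sqrt]
    exact_mod_cast hR

end Deviation

theorem theorem3 {N : ℕ} (hN : 1 ≤ N) (I : Fin N → ℕ)
    (hI : ∀ n, ((N : ℝ) - 1) * Real.logb 2 ((Finset.univ.sup I : ℕ) : ℝ) ^ 2 + 1 ≤ (I n : ℝ))
    (β α : ℝ) (hβ : 0 < β) (hβα : β ≤ α) (R Rhat : ℕ)
    (M : RealTensor I)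
    (k : ℕ) (hk : 1 ≤ k) (hkI : k ≤ ∏ n, I n)
    {Λ : Type*} [MeasurableSpace Λ] (P : Measure Λ) [IsProbabilityMeasure P]
    (Ω : Λ → Finset (MultiIndex I)) (X : Λ → MultiIndex I → ℕ)
    (hX : IsPoissonSampling P M k Ω X) :
    (M ∈ nncpSpace I R β α →
      1 - 2 / (k : ℝ) < P.real {w | ∀ Mhat ∈ nncpSpace I Rhat β α,
        poissonLogLik (Ω w) (X w) M ≤ poissonLogLik (Ω w) (X w) Mhat →
        ‖M - Mhat‖ ^ 2 / ‖M‖ ^ 2 ≤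
          128 * α * (α + 1) / β ^ 3 * (α * (Real.exp 2 - 2) + 3 * Real.logb 2 (k : ℝ)) *
            (((R : ℝ) + Rhat) * √(∑ n, (I n : ℝ)) / √(k : ℝ))}) ∧
    (M ∈ cpSpace I R β α →
      1 - 2 / (k : ℝ) < P.real {w | ∀ Mhat ∈ cpSpace I Rhat β α,
        poissonLogLik (Ω w) (X w) M ≤ poissonLogLik (Ω w) (X w) Mhat →
        ‖M - Mhat‖ ^ 2 / ‖M‖ ^ 2 ≤
          128 * α * (α + 1) / β ^ 3 * (α * (Real.exp 2 - 2) + 3 * Real.logb 2 (k : ℝ)) *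
            (((R * √(R : ℝ)) ^ (N - 1) + (Rhat * √(Rhat : ℝ)) ^ (N - 1)) *
              (√(∑ n, (I n : ℝ)) / √(k : ℝ)))}) := by
  have hI0 (n) : 0 < I n := by
    have h1 : (0 : ℝ) ≤ (N : ℝ) - 1 := sub_nonneg.2 (by exact_mod_cast hN)
    have h2 := mul_nonneg h1 (sq_nonneg (Real.logb 2 ((Finset.univ.sup I : ℕ) : ℝ)))
    have h3 : (0 : ℝ) < I n := by linarith [hI n]
    exact_mod_cast h3
  have hα : 0 < α := hβ.trans_le hβα
  constructor
  · intro hM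
    have hR : (1 : ℝ) ≤ R := by
      exact_mod_cast one_le_of_mem_cpSpace hI0 hβ (nncpSpace_subset_cpSpace R β α hM)
    have hRhat : (0 : ℝ) ≤ Rhat := Nat.cast_nonneg _
    have := hX.one_sub_lt_measureReal hN hI0 hk hkI hβ hβα hM.1
      (by linarith : 1 ≤ (R : ℝ) + Rhat) (nncpSpace I Rhat β α) (fun T hT => hT.1)
      (fun T hT => ((cubeBounded_of_nncpSpace hα.le hI0 hT).sub
        (cubeBounded_of_nncpSpace hα.le hI0 hM)).mono (by linarith))
    simpa only [mul_div_assoc] using this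
  · intro hM
    have hR : (1 : ℝ) ≤ R := by exact_mod_cast one_le_of_mem_cpSpace hI0 hβ hM
    have hRhat : (0 : ℝ) ≤ (Rhat * √(Rhat : ℝ)) ^ (N - 1) := by positivity
    have hpow : (1 : ℝ) ≤ (R * √(R : ℝ)) ^ (N - 1) :=
      (one_le_pow₀ hR).trans (pow_le_mul_sqrt_pow R (N - 1))
    refine hX.one_sub_lt_measureReal hN hI0 hk hkI hβ hβα hM.1 (by linarith)
      (cpSpace I Rhat β α) (fun T hT => hT.1) (fun T hT =>
        ((cubeBounded_of_cpSpace hN hI0 hβ hα hT).sub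
          (cubeBounded_of_cpSpace hN hI0 hβ hα hM)).mono ?_)
    -- The slice expansion gives `R ^ (N - 1)`, which is at most the stated `(R * √R) ^ (N - 1)`.
    rw [← add_mul, add_comm]
    exact mul_le_mul_of_nonneg_right
      (add_le_add (pow_le_mul_sqrt_pow R _) (pow_le_mul_sqrt_pow Rhat _)) hα.le
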